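/- **Conventions.** A uniform commutative monoid is a commutative monoid with a uniformity for which addition is uniformly continuous; $Z$ is assumed Hausdorff. Let $S$ be a set, $\mathcal K,\mathcal G$ families of subsets of $S$, $X,Z$ uniform commutative monoids, $\mathcal B$ a family of subsets of $X$, $\mathcal F$ a set of functions $S\to X$, $\mathcal T$ a uniformity on $\mathcal F$, and $\mathcal F_B=\{f\in\mathcal F:\operatorname{rng} f\subseteq B\}$. Write $f\prec\alpha$ ($f$ is supported by $\alpha$) if $f=0$ off some $\kappa\in\mathcal K$ with $\kappa\subseteq\alpha$, write $\alpha=_xf$ if $f=x$ on some $\gamma\in\mathcal G$ with $\alpha\subseteq\gamma$, and let $H_x=\bigcap\{B\in\mathcal B:x\in B\}$. $\Re=(S,(\mathcal K,\mathcal G),(X,\mathcal B),(\mathcal F,\mathcal T))$ is a **Riesz system** if: (1) $\mathcal K$ is closed under finite unions; (2) $\mathcal G$ is closed under finite unions and finite intersections (including $\bigcup\emptyset=\emptyset$ in both cases, and $\bigcap\emptyset:=\bigcup\mathcal G$); (3) $\kappa\setminus\gamma\in\mathcal K$ and $\gamma\setminus\kappa\in\mathcal G$ for $\kappa\in\mathcal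 K,\gamma\in\mathcal G$; (4) if $\kappa\subseteq\gamma$ with $\kappa\in\mathcal K$, $\gamma\in\mathcal G$, then $\kappa\subseteq\gamma'\subseteq\kappa'\subseteq\gamma$ for some $\gamma'\in\mathcal G,\kappa'\in\mathcal K$; (5) $\mathcal B$ is closed under non-empty intersections and $0\in\bigcap\mathcal B$; (6) for $B,B'\in\mathcal B$ some $C\in\mathcal B$ contains $B+B'$; (7) $\bigcup\mathcal B=X$; (8) $0\in\mathcal F$, and $\mathcal F$ is a uniform commutative monoid under pointwise addition and $\mathcal T$; (9) each $f\in\mathcal F$ lies in some $\mathcal F_B$, $B\in\mathcal B$; (10) for each $f\in\mathcal F$ and each entourage $W$ of $X$ there is a finite $G\subseteq\mathcal G$ with $\bigcup G=S$ and $(f(s),f(t))\in W$ for all $s,t\in\gamma\in G$; (11) for $\kappa\in\mathcal K$, $\gamma\in\mathcal G$, $\kappa\subseteq\gamma$ and $x\in X$ there is $f\in\mathcal F_{H_x}$ with $\kappa=_xf\prec\gamma$; (12) for $B\in\mathcal B$, $T\in\mathcal T$ there is an entourage $U$ of $X$ such that, whenever $\mathcal K\ni\kappa\subseteq\gamma\in\mathcal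 G$, $f,g\in\mathcal F_B$, $f,g\prec\gamma$ and $(f(s),g(s))\in U$ for all $s\in\omega$, for some $\omega\in\mathcal G$ with $\kappa\subseteq\omega\subseteq\gamma$, there are $p,q\in\mathcal F_B$ with $p,q\prec\gamma\setminus\kappa$ and $(f+p,g+q)\in T$; (13) for $B\in\mathcal B$, finite $G\subseteq\mathcal G$, $\kappa\in\mathcal K$ with $\kappa\subseteq\bigcup G$, and $f\in\mathcal F_B$, there are $g_\gamma\in\mathcal F_B$ ($\gamma\in G$) with $g_\gamma\prec\gamma$, $\sum_{\gamma\in J}g_\gamma\in\mathcal F_B$ for all $J\subseteq G$, and $f=\sum_{\gamma\in G}g_\gamma$ on $\kappa$. A map $\ell:\mathcal F\to Z$ with $\ell(0)=0$ is a **Riesz integral** over the Riesz system $\Re$ if: $\ell(f+g)=\ell(f)+\ell(g)$ whenever $f\prec E$, $g\prec E'$ for disjoint $E,E'$ in the field of sets generated by $\mathcal K\cup\mathcal G$; for all $B\in\mathcal B$, entourages $W$ of $Z$ and disjoint sequences $(G_n)$ in $\mathcal G$ there is $m$ with $(\ell(f),\ell(f+g))\in W$ for all $n>m$ and $f,g\in\mathcal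 F_B$ with $g\prec G_n$; and, for each $B\in\mathcal B$, $\ell$ is uniformly continuous on $\mathcal F_B$ and $\ell(\mathcal F_B)$ has complete closure. For $\kappa\in\mathcal K$ let $\tau_\ell(\kappa)(x)$ be the limit of the filter base $\{\ell(f): f\in\mathcal F_{H_x},\ \kappa=_xf\prec\gamma\}$ ($\kappa\subseteq\gamma\in\mathcal G$). In $Z^X$ with pointwise convergence let $$\xi_\ell(\gamma)=\lim_{\kappa\in\mathcal K,\ \kappa\subseteq\gamma}\tau_\ell(\kappa)\quad(\gamma\in\mathcal G),\qquad \nu_\ell(\alpha)=\lim_{\gamma\in\mathcal G,\ \alpha\subseteq\gamma}\xi_\ell(\gamma)\quad(\alpha\subseteq S).$$ For $h$ from the subsets of $S$ to $Z^X$, a set $\alpha\subseteq S$ is $W$-small with respect to $(h,B)$ if there is $\gamma\in\mathcal G$ with $\alpha\subseteq\gamma$ and $\bigl(\sum_{\kappa\in K}h(\kappa)(x_\kappa),\sum_{\kappa\in K}h(\kappa)(x_\kappa+y_\kappa)\bigr)\in W$ for all finite disjoint $K\subseteq\mathcal K$ with $\bigcup K\subseteq\gamma$ and all $x,y:K\to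 B$. Let $\mathcal R_h$ be the family of all $\alpha\subseteq S$ such that for all $B\in\mathcal B$ and entourages $V$ of $Z$ there are $\kappa\in\mathcal K$, $\gamma\in\mathcal G$ with $\kappa\subseteq\alpha\subseteq\gamma$ and $\gamma\setminus\kappa$ $V$-small with respect to $(h,B)$. A set $\alpha\subseteq S$ is $U$-small with respect to $(\ell,B)$ if there is $\gamma\in\mathcal G$ with $\alpha\subseteq\gamma$ such that $(\ell(f),\ell(f+g))\in U$ for all $f,g\in\mathcal F_B$ with $g\prec\gamma$. The map $\ell$ is **$\mathcal G$-bounded** if for all entourages $U$ of $Z$, $B\in\mathcal B$, $K\in\mathcal K$ and $\mathcal G'\subseteq\mathcal G$ with $K\subseteq\bigcup\mathcal G'$ there is a finite $\mathcal H\subseteq\mathcal G'$ such that $K\setminus\bigcup\mathcal H$ is $U$-small with respect to $(\ell,B)$. **Theorem.** Let $\ell$ be a $Z$-valued Riesz integral over a Riesz system $\Re$. If $\ell$ is $\mathcal G$-bounded, then $\nu_\ell$ is $\sigma$-additive. That is: all the limits defining $\nu_\ell$ exist, $\mathcal R_{\nu_\ell}$ is a field of subsets of $S$ containing $\mathcal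 K\cup\mathcal G$, and $\nu_\ell$ is a countably additive measure on it: $\nu_\ell(\emptyset)=0$, $\nu_\ell(A\cup B)+\nu_\ell(A\cap B)=\nu_\ell(A)+\nu_\ell(B)$ for $A,B\in\mathcal R_{\nu_\ell}$, and $\nu_\ell\bigl(\bigcup_nA_n\bigr)=\sum_n\nu_\ell(A_n)$ (unconditionally convergent in $Z^X$, pointwise on $X$) for every disjoint sequence $(A_n)$ in $\mathcal R_{\nu_\ell}$ with $\bigcup_nA_n\in\mathcal R_{\nu_\ell}$. -/

import Mathlib

open Filter Topology Uniformity

/-- A uniform commutative monoid: addition is uniformly continuous on `M × M`. -/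
class IsUniformAddCommMonoid (M : Type*) [UniformSpace M] [AddCommMonoid M] : Prop where
  uniformContinuous_add : UniformContinuous fun p : M × M => p.1 + p.2

namespace RieszRep

variable {S X Z : Type*}

/-- `f` is supported by `α`: `f` vanishes off some member of `𝓚` contained in `α`. -/
def SupportedBy [Zero X] (𝓚 : Set (Set S)) (f : S → X) (α : Set S) : Prop :=
  ∃ κ ∈ 𝓚, κ ⊆ α ∧ ∀ s, s ∉ κ → f s = 0

/-- `f` equals `x` over `α`: `f` is constantly `x` on some member of `𝓖` containing `α`. -/
def EqualsOver (𝓖 : Set (Set S)) (f : S → X) (x : X) (α : Set S) : Prop :=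
  ∃ γ ∈ 𝓖, α ⊆ γ ∧ ∀ s ∈ γ, f s = x

/-- The `𝓑`-hull of a point: the intersection of all members of `𝓑` containing it. -/
def hull (𝓑 : Set (Set X)) (x : X) : Set X :=
  ⋂₀ {B | B ∈ 𝓑 ∧ x ∈ B}

/-- The members of `F` with range in `B`. -/
def inRange [AddCommMonoid X] (F : AddSubmonoid (S → X)) (B : Set X) : Set F :=
  {f | Set.range (f : S → X) ⊆ B}

/-- A Riesz system `(S, (𝓚, 𝓖), (X, 𝓑), (F, T))`. That `F` contains the zero function and is closed
under pointwise addition is part of the type of `F`. -/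
structure IsRieszSystem [UniformSpace X] [AddCommMonoid X] (𝓚 𝓖 : Set (Set S))
    (𝓑 : Set (Set X)) (F : AddSubmonoid (S → X)) (T : UniformSpace F) : Prop where
  /-- `𝓚` is closed under finite unions (in particular it contains the empty set). -/
  K_sUnion : ∀ H ⊆ 𝓚, H.Finite → ⋃₀ H ∈ 𝓚
  /-- `𝓖` is closed under finite unions (in particular it contains the empty set). -/
  G_sUnion : ∀ H ⊆ 𝓖, H.Finite → ⋃₀ H ∈ 𝓖
  /-- `𝓖` is closed under finite intersections, -/
  G_sInter : ∀ H ⊆ 𝓖, H.Finite → H.Nonempty → ⋂₀ H ∈ 𝓖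
  /-- the empty intersection being read as the union of `𝓖`. -/
  G_sInter_empty : ⋃₀ 𝓖 ∈ 𝓖
  K_diff_G : ∀ κ ∈ 𝓚, ∀ γ ∈ 𝓖, κ \ γ ∈ 𝓚
  G_diff_K : ∀ κ ∈ 𝓚, ∀ γ ∈ 𝓖, γ \ κ ∈ 𝓖
  interpolate : ∀ κ ∈ 𝓚, ∀ γ ∈ 𝓖, κ ⊆ γ →
    ∃ γ' ∈ 𝓖, ∃ κ' ∈ 𝓚, κ ⊆ γ' ∧ γ' ⊆ κ' ∧ κ' ⊆ γ
  B_sInter : ∀ C ⊆ 𝓑, C.Nonempty → ⋂₀ C ∈ 𝓑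
  zero_mem_B : ∀ B ∈ 𝓑, (0 : X) ∈ B
  B_add : ∀ B ∈ 𝓑, ∀ B' ∈ 𝓑, ∃ C ∈ 𝓑, ∀ b ∈ B, ∀ b' ∈ B', b + b' ∈ C
  B_cover : ∀ x : X, ∃ B ∈ 𝓑, x ∈ B
  uniform_add :
    @UniformContinuous (F × F) F (@instUniformSpaceProd F F T T) T (fun p => p.1 + p.2)
  range_subset : ∀ f : F, ∃ B ∈ 𝓑, f ∈ inRange F B
  /-- Every `f ∈ F` is finitely `𝓖`-partitionable. -/
  partitionable : ∀ f : F, ∀ W ∈ 𝓤 X, ∃ H ⊆ 𝓖, H.Finite ∧ ⋃₀ H = Set.univ ∧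
    ∀ γ ∈ H, ∀ s ∈ γ, ∀ t ∈ γ, ((f : S → X) s, (f : S → X) t) ∈ W
  exists_bump : ∀ κ ∈ 𝓚, ∀ γ ∈ 𝓖, κ ⊆ γ → ∀ x : X, ∃ f ∈ inRange F (hull 𝓑 x),
    SupportedBy 𝓚 (f : S → X) γ ∧ EqualsOver 𝓖 (f : S → X) x κ
  /-- Functions that are close near `κ` have extensions that are close everywhere. -/
  extend : ∀ B ∈ 𝓑, ∀ V ∈ 𝓤[T], ∃ U ∈ 𝓤 X, ∀ κ ∈ 𝓚, ∀ γ ∈ 𝓖, κ ⊆ γ →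
    ∀ f ∈ inRange F B, ∀ g ∈ inRange F B,
    SupportedBy 𝓚 (f : S → X) γ → SupportedBy 𝓚 (g : S → X) γ →
    (∃ ω ∈ 𝓖, κ ⊆ ω ∧ ω ⊆ γ ∧ ∀ s ∈ ω, ((f : S → X) s, (g : S → X) s) ∈ U) →
    ∃ p ∈ inRange F B, ∃ q ∈ inRange F B,
      SupportedBy 𝓚 (p : S → X) (γ \ κ) ∧ SupportedBy 𝓚 (q : S → X) (γ \ κ) ∧
      (f + p, g + q) ∈ V
  /-- Partitions of unity. -/
  partition : ∀ B ∈ 𝓑, ∀ H : Finset (Set S), (H : Set (Set S)) ⊆ 𝓖 →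
    ∀ κ ∈ 𝓚, κ ⊆ ⋃₀ (H : Set (Set S)) → ∀ f ∈ inRange F B,
    ∃ g : Set S → F, (∀ γ ∈ H, g γ ∈ inRange F B ∧ SupportedBy 𝓚 (g γ : S → X) γ) ∧
      (∀ J ⊆ H, ∑ γ ∈ J, g γ ∈ inRange F B) ∧
      ∀ s ∈ κ, (f : S → X) s = ∑ γ ∈ H, (g γ : S → X) s

/-- `f` and `g` are supported by disjoint members of the field generated by `𝓚 ∪ 𝓖`. -/
def Separated [Zero X] (𝓚 𝓖 : Set (Set S)) (f g : S → X) : Prop :=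
  ∃ E ∈ MeasureTheory.generateSetAlgebra (𝓚 ∪ 𝓖),
    ∃ E' ∈ MeasureTheory.generateSetAlgebra (𝓚 ∪ 𝓖),
      Disjoint E E' ∧ SupportedBy 𝓚 f E ∧ SupportedBy 𝓚 g E'

/-- The members `α` of `𝓖` such that adding a `g ∈ F_B` supported by `α` to any `f ∈ F_B` moves
`ℓ f` by at most `W`. -/
def smallOpens [AddCommMonoid X] (𝓚 𝓖 : Set (Set S)) {F : AddSubmonoid (S → X)}
    (ℓ : F → Z) (B : Set X) (W : Set (Z × Z)) : Set (Set S) :=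
  {α | α ∈ 𝓖 ∧ ∀ f ∈ inRange F B, ∀ g ∈ inRange F B,
    SupportedBy 𝓚 (g : S → X) α → (ℓ f, ℓ (f + g)) ∈ W}

/-- `ℓ` is a `Z`-valued Riesz integral over the Riesz system `(S, (𝓚, 𝓖), (X, 𝓑), (F, T))`. -/
structure IsRieszIntegral [UniformSpace X] [AddCommMonoid X] [UniformSpace Z] [AddCommMonoid Z]
    (𝓚 𝓖 : Set (Set S)) (𝓑 : Set (Set X)) (F : AddSubmonoid (S → X)) (T : UniformSpace F)
    (ℓ : F → Z) : Prop where
  system : IsRieszSystem 𝓚 𝓖 𝓑 F T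
  map_zero : ℓ 0 = 0
  map_add : ∀ f g : F, Separated 𝓚 𝓖 (f : S → X) (g : S → X) → ℓ (f + g) = ℓ f + ℓ g
  /-- `ℓ` is `s`-bounded over `𝓑`. -/
  sBounded : ∀ B ∈ 𝓑, ∀ W ∈ 𝓤 Z, ∀ γ : ℕ → Set S, (∀ n, γ n ∈ 𝓖) →
    Pairwise (fun i j => Disjoint (γ i) (γ j)) →
    ∃ m : ℕ, ∀ n > m, ∀ f ∈ inRange F B, ∀ g ∈ inRange F B,
      SupportedBy 𝓚 (g : S → X) (γ n) → (ℓ f, ℓ (f + g)) ∈ W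
  uniformContinuousOn : ∀ B ∈ 𝓑, @UniformContinuousOn F Z T _ ℓ (inRange F B)
  /-- `ℓ` maps each `F_B` onto a relatively complete subset of `Z`. -/
  relComplete : ∀ B ∈ 𝓑, IsComplete (closure (ℓ '' inRange F B))

/-- A subset `α` of `S` is `W`-small with respect to `ℓ` (and `B`): it is contained in a member of
`𝓖` such that `(ℓ f, ℓ (f + g)) ∈ W` for all `f, g ∈ F_B` with `g` supported by that member. -/
def SmallFor [AddCommMonoid X] (𝓚 𝓖 : Set (Set S)) {F : AddSubmonoid (S → X)}
    (ℓ : F → Z) (B : Set X) (W : Set (Z × Z)) (α : Set S) : Prop :=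
  ∃ γ ∈ smallOpens 𝓚 𝓖 ℓ B W, α ⊆ γ

/-- `ℓ` is `𝓖`-bounded: every cover of a `K ∈ 𝓚` by members of `𝓖` has finite subfamilies that
cover `K` up to arbitrarily small sets. -/
def GBounded [AddCommMonoid X] [UniformSpace Z] (𝓚 𝓖 : Set (Set S)) (𝓑 : Set (Set X))
    {F : AddSubmonoid (S → X)} (ℓ : F → Z) : Prop :=
  ∀ U ∈ 𝓤 Z, ∀ B ∈ 𝓑, ∀ K ∈ 𝓚, ∀ G' ⊆ 𝓖, K ⊆ ⋃₀ G' →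
    ∃ H ⊆ G', H.Finite ∧ SmallFor 𝓚 𝓖 ℓ B U (K \ ⋃₀ H)

section Measure

variable [AddCommMonoid X] [UniformSpace Z] [AddCommMonoid Z]

/-- The filter on `Z` generated by the sets `ℓ '' {f ∈ F | range f ⊆ hull x, f equals x over κ,
f is supported by γ}`, where `γ` runs through the members of `𝓖` that contain `κ`. -/
def tauFilter (𝓚 𝓖 : Set (Set S)) (𝓑 : Set (Set X)) {F : AddSubmonoid (S → X)} (ℓ : F → Z)
    (κ : Set S) (x : X) : Filter Z :=
  ⨅ γ ∈ {γ | γ ∈ 𝓖 ∧ κ ⊆ γ}, 𝓟 (ℓ '' {f | f ∈ inRange F (hull 𝓑 x) ∧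
    EqualsOver 𝓖 (f : S → X) x κ ∧ SupportedBy 𝓚 (f : S → X) γ})

/-- `τ_ℓ(κ)(x)`, for `κ ∈ 𝓚`: the limit of `tauFilter`. -/
noncomputable def tau (𝓚 𝓖 : Set (Set S)) (𝓑 : Set (Set X)) {F : AddSubmonoid (S → X)}
    (ℓ : F → Z) (κ : Set S) (x : X) : Z :=
  lim (tauFilter 𝓚 𝓖 𝓑 ℓ κ x)

/-- `ξ_ℓ(γ)`, for `γ ∈ 𝓖`: the limit in `Z^X` (pointwise on `X`) of `τ_ℓ(κ)` over the `κ ∈ 𝓚`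
contained in `γ`, directed by `⊆`. -/
noncomputable def xi (𝓚 𝓖 : Set (Set S)) (𝓑 : Set (Set X)) {F : AddSubmonoid (S → X)}
    (ℓ : F → Z) (γ : Set S) : X → Z :=
  limUnder (atTop : Filter {κ : Set S // κ ∈ 𝓚 ∧ κ ⊆ γ}) (fun κ => tau 𝓚 𝓖 𝓑 ℓ κ.1)

/-- `ν_ℓ(α)`: the limit in `Z^X` of `ξ_ℓ(γ)` over the `γ ∈ 𝓖` containing `α`, directed by `⊇`. -/
noncomputable def nu (𝓚 𝓖 : Set (Set S)) (𝓑 : Set (Set X)) {F : AddSubmonoid (S → X)}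
    (ℓ : F → Z) (α : Set S) : X → Z :=
  limUnder (atBot : Filter {γ : Set S // γ ∈ 𝓖 ∧ α ⊆ γ}) (fun γ => xi 𝓚 𝓖 𝓑 ℓ γ.1)

/-- All the limits in the definition of `ν_ℓ` exist. -/
structure NuWellDefined (𝓚 𝓖 : Set (Set S)) (𝓑 : Set (Set X)) {F : AddSubmonoid (S → X)}
    (ℓ : F → Z) : Prop where
  tauFilter_neBot : ∀ κ ∈ 𝓚, ∀ x, (tauFilter 𝓚 𝓖 𝓑 ℓ κ x).NeBot
  tau_lim : ∀ κ ∈ 𝓚, ∀ x, tauFilter 𝓚 𝓖 𝓑 ℓ κ x ≤ 𝓝 (tau 𝓚 𝓖 𝓑 ℓ κ x)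
  xi_lim : ∀ γ ∈ 𝓖, Tendsto (fun κ : {κ : Set S // κ ∈ 𝓚 ∧ κ ⊆ γ} => tau 𝓚 𝓖 𝓑 ℓ κ.1)
    atTop (𝓝 (xi 𝓚 𝓖 𝓑 ℓ γ))
  nu_lim : ∀ α : Set S, Tendsto (fun γ : {γ : Set S // γ ∈ 𝓖 ∧ α ⊆ γ} => xi 𝓚 𝓖 𝓑 ℓ γ.1)
    atBot (𝓝 (nu 𝓚 𝓖 𝓑 ℓ α))

/-- `α` is `W`-small with respect to `(h, B)`; only the values of `h` on `𝓚` matter. -/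
def SmallForMeasure (𝓚 𝓖 : Set (Set S)) (h : Set S → X → Z) (B : Set X) (W : Set (Z × Z))
    (α : Set S) : Prop :=
  ∃ γ ∈ 𝓖, α ⊆ γ ∧ ∀ K : Finset (Set S), (K : Set (Set S)) ⊆ 𝓚 →
    (K : Set (Set S)).PairwiseDisjoint id → ⋃₀ (K : Set (Set S)) ⊆ γ →
    ∀ x y : Set S → X, (∀ κ ∈ K, x κ ∈ B) → (∀ κ ∈ K, y κ ∈ B) →
      (∑ κ ∈ K, h κ (x κ), ∑ κ ∈ K, h κ (x κ + y κ)) ∈ W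

/-- The family `ℛ_h` of the subsets of `S` that are regular with respect to `(h, 𝓚, 𝓖, 𝓑)`. -/
def regularSets (𝓚 𝓖 : Set (Set S)) (𝓑 : Set (Set X)) (h : Set S → X → Z) : Set (Set S) :=
  {α | ∀ B ∈ 𝓑, ∀ V ∈ 𝓤 Z, ∃ κ ∈ 𝓚, ∃ γ ∈ 𝓖, κ ⊆ α ∧ α ⊆ γ ∧
    SmallForMeasure 𝓚 𝓖 h B V (γ \ κ)}

end Measure

/-- `h` is a countably additive measure on the field `R` of subsets of `S`. -/
structure IsCountablyAdditiveOn {M : Type*} [TopologicalSpace M] [AddCommMonoid M]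
    (h : Set S → M) (R : Set (Set S)) : Prop where
  isSetAlgebra : MeasureTheory.IsSetAlgebra R
  map_empty : h ∅ = 0
  map_union_add_inter : ∀ A ∈ R, ∀ B ∈ R, h (A ∪ B) + h (A ∩ B) = h A + h B
  hasSum : ∀ A : ℕ → Set S, (∀ n, A n ∈ R) → Pairwise (fun i j => Disjoint (A i) (A j)) →
    (⋃ n, A n) ∈ R → HasSum (fun n => h (A n)) (h (⋃ n, A n))

end RieszRep

namespace RieszRep

variable {S X Z : Type*}

/-! `Z` has no subtraction, so a set counts as small when adding a function supported there barely
changes `ℓ`. Exhaustion by disjoint sequences (`sBounded`) shows that each `κ ∈ 𝓚` has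
neighbourhoods `γ ∈ 𝓖` with `γ \ κ` small, and that each `γ ∈ 𝓖` is approximated in this sense from
inside by members of `𝓚`.

Two functions that agree near `κ` and live on such a `γ` have nearly equal integrals: the extension
axiom corrects them on `γ \ κ` until they are close everywhere, and `ℓ` is uniformly continuous
(`exists_map_add_mem`). Hence the filters defining `τ` are Cauchy, and completeness gives their
limits. Bumps with disjoint supports make `τ` additive; discarding a thin neighbourhood of a subset
gives tightness (`exists_tau_add_mem`); approximating finite sums of values of `τ` by single
integrals transfers smallness from `ℓ` to `τ` (`exists_smallForMeasure_tau`).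

From there only the properties collected in `IsTightContent` matter. Small sets are stable under
finite unions, at the price of a smaller entourage (`exists_smallForMeasure_union`); with exhaustion
this makes the nets for `ξ` and `ν` Cauchy, gives `ν = τ` on `𝓚`, and makes `ν` additive on the
field of regular sets.

For σ-additivity, take `κ` inside the union of a disjoint sequence of regular sets and enlarge each
term to a member of `𝓖`, with rapidly decreasing errors. `𝓖`-boundedness extracts finitely many
enlargements covering `κ` up to a small set. The union minus finitely many terms is then small, and
`ν` is close to zero on small sets. -/

theorem mem_inRange [AddCommMonoid X] {F : AddSubmonoid (S → X)} {B : Set X} {f : F} :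
    f ∈ inRange F B ↔ ∀ s, (f : S → X) s ∈ B :=
  Set.range_subset_iff

theorem inRange_mono [AddCommMonoid X] {F : AddSubmonoid (S → X)} {B C : Set X} (h : B ⊆ C) :
    inRange F B ⊆ inRange F C :=
  fun _ hf => hf.trans h

theorem add_mem_inRange [AddCommMonoid X] {F : AddSubmonoid (S → X)} {B C D : Set X}
    (h : ∀ b ∈ B, ∀ c ∈ C, b + c ∈ D) {f g : F} (hf : f ∈ inRange F B) (hg : g ∈ inRange F C) :
    f + g ∈ inRange F D :=
  mem_inRange.2 fun s => h _ (mem_inRange.1 hf s) _ (mem_inRange.1 hg s)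

theorem SupportedBy.mono [Zero X] {𝓚 : Set (Set S)} {f : S → X} {α β : Set S}
    (h : SupportedBy 𝓚 f α) (hαβ : α ⊆ β) : SupportedBy 𝓚 f β :=
  let ⟨κ, hκ, hκα, hf⟩ := h
  ⟨κ, hκ, hκα.trans hαβ, hf⟩

theorem SupportedBy.eq_zero [Zero X] {𝓚 : Set (Set S)} {f : S → X} {α : Set S}
    (h : SupportedBy 𝓚 f α) {s : S} (hs : s ∉ α) : f s = 0 :=
  let ⟨_, _, hκα, hf⟩ := h
  hf s fun hsκ => hs (hκα hsκ)

theorem add_mem_inRange_of_disjoint [AddCommMonoid X] {𝓚 : Set (Set S)}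
    {F : AddSubmonoid (S → X)} {B : Set X} {f g : F}
    {α β : Set S} (hαβ : Disjoint α β) (hf : f ∈ inRange F B) (hg : g ∈ inRange F B)
    (hfα : SupportedBy 𝓚 (f : S → X) α) (hgβ : SupportedBy 𝓚 (g : S → X) β) :
    f + g ∈ inRange F B := by
  refine mem_inRange.2 fun s => ?_
  change (f : S → X) s + (g : S → X) s ∈ B
  by_cases hs : s ∈ α
  · rw [hgβ.eq_zero (Set.disjoint_left.1 hαβ hs), add_zero]
    exact mem_inRange.1 hf s
  · rw [hfα.eq_zero hs, zero_add]
    exact mem_inRange.1 hg s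

theorem separated_of_disjoint [AddCommMonoid X] {𝓚 𝓖 : Set (Set S)}
    {F : AddSubmonoid (S → X)} {f g : F} {γ γ' : Set S} (hγ : γ ∈ 𝓖) (hγ' : γ' ∈ 𝓖)
    (hd : Disjoint γ γ') (hf : SupportedBy 𝓚 (f : S → X) γ) (hg : SupportedBy 𝓚 (g : S → X) γ') :
    Separated 𝓚 𝓖 (f : S → X) (g : S → X) :=
  ⟨γ, MeasureTheory.self_subset_generateSetAlgebra (Or.inr hγ), γ',
    MeasureTheory.self_subset_generateSetAlgebra (Or.inr hγ'), hd, hf, hg⟩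

theorem EqualsOver.mono {𝓖 : Set (Set S)} {f : S → X} {x : X} {α β : Set S}
    (h : EqualsOver 𝓖 f x β) (hαβ : α ⊆ β) : EqualsOver 𝓖 f x α :=
  let ⟨γ, hγ, hβγ, hf⟩ := h
  ⟨γ, hγ, hαβ.trans hβγ, hf⟩

theorem smallOpens_anti [AddCommMonoid X] {𝓚 𝓖 : Set (Set S)} {F : AddSubmonoid (S → X)}
    {ℓ : F → Z} {B : Set X} {W : Set (Z × Z)} {α β : Set S} (hβ : β ∈ smallOpens 𝓚 𝓖 ℓ B W)
    (hα : α ∈ 𝓖) (h : α ⊆ β) : α ∈ smallOpens 𝓚 𝓖 ℓ B W :=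
  ⟨hα, fun f hf g hg hgα => hβ.2 f hf g hg (hgα.mono h)⟩

theorem smallOpens_mono [AddCommMonoid X] {𝓚 𝓖 : Set (Set S)} {F : AddSubmonoid (S → X)}
    {ℓ : F → Z} {B C : Set X} {V W : Set (Z × Z)} (hBC : B ⊆ C) (hVW : V ⊆ W) :
    smallOpens 𝓚 𝓖 ℓ C V ⊆ smallOpens 𝓚 𝓖 ℓ B W :=
  fun _ hα => ⟨hα.1, fun f hf g hg hgα =>
    hVW (hα.2 f (inRange_mono hBC hf) g (inRange_mono hBC hg) hgα)⟩

theorem hull_subset {𝓑 : Set (Set X)} {B : Set X} (hB : B ∈ 𝓑) {x : X} (hx : x ∈ B) :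
    hull 𝓑 x ⊆ B :=
  Set.sInter_subset_of_mem ⟨hB, hx⟩

theorem mem_hull (𝓑 : Set (Set X)) (x : X) : x ∈ hull 𝓑 x :=
  fun _ hB => hB.2

/-! ### Entourages and dependent choice. -/

theorem exists_symm_comp_three [UniformSpace Z] {W : Set (Z × Z)} (hW : W ∈ 𝓤 Z) :
    ∃ V ∈ 𝓤 Z, V ⊆ W ∧ (∀ a b, (a, b) ∈ V → (b, a) ∈ V) ∧
      ∀ a b c d, (a, b) ∈ V → (b, c) ∈ V → (c, d) ∈ V → (a, d) ∈ W := by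
  obtain ⟨V₁, hV₁, h₁⟩ := comp_mem_uniformity_sets hW
  obtain ⟨V₂, hV₂, hs, h₂⟩ := comp_symm_mem_uniformity_sets hV₁
  refine ⟨V₂, hV₂, fun p hp => ?_, fun a b h => hs.symm _ _ h, fun a b c d hab hbc hcd => ?_⟩
  · exact h₁ ⟨p.2, h₂ ⟨p.2, hp, refl_mem_uniformity hV₂⟩, refl_mem_uniformity hV₁⟩
  · exact h₁ ⟨c, h₂ ⟨b, hab, hbc⟩, h₂ ⟨d, hcd, refl_mem_uniformity hV₂⟩⟩

theorem exists_add_mem_uniformity [UniformSpace Z] [AddCommMonoid Z] [IsUniformAddCommMonoid Z]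
    {W : Set (Z × Z)} (hW : W ∈ 𝓤 Z) :
    ∃ V ∈ 𝓤 Z, ∀ a b c d : Z, (a, b) ∈ V → (c, d) ∈ V → (a + c, b + d) ∈ W := by
  have h := IsUniformAddCommMonoid.uniformContinuous_add (M := Z) hW
  rw [mem_map, uniformity_prod_eq_comap_prod, mem_comap] at h
  obtain ⟨t, ht, hts⟩ := h
  obtain ⟨V, hV, hVt⟩ := mem_prod_same_iff.1 ht
  exact ⟨V, hV, fun a b c d h₁ h₂ =>
    hts (show ((a, c), (b, d)) ∈ _ from hVt (Set.mk_mem_prod h₁ h₂))⟩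

theorem exists_sum_mem_uniformity [UniformSpace Z] [AddCommMonoid Z] [IsUniformAddCommMonoid Z]
    {ι : Type*} (s : Finset ι) {W : Set (Z × Z)} (hW : W ∈ 𝓤 Z) :
    ∃ V ∈ 𝓤 Z, ∀ a b : ι → Z, (∀ i ∈ s, (a i, b i) ∈ V) → (∑ i ∈ s, a i, ∑ i ∈ s, b i) ∈ W := by
  classical
  induction s using Finset.induction_on generalizing W with
  | empty => exact ⟨Set.univ, univ_mem, fun a b _ => by simpa using refl_mem_uniformity hW⟩
  | insert i s hi ih =>
    obtain ⟨V, hV, h⟩ := exists_add_mem_uniformity hW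
    obtain ⟨V', hV', h'⟩ := ih hV
    refine ⟨V ∩ V', inter_mem hV hV', fun a b hab => ?_⟩
    rw [Finset.sum_insert hi, Finset.sum_insert hi]
    exact h _ _ _ _ (hab i (Finset.mem_insert_self _ _)).1
      (h' a b fun j hj => (hab j (Finset.mem_insert_of_mem hj)).2)

theorem eq_of_forall_mem_uniformity [UniformSpace Z] [T2Space Z] {a b : Z}
    (h : ∀ W ∈ 𝓤 Z, (a, b) ∈ W) : a = b :=
  eq_of_uniformity fun {W} hW => h W hW

/-- Dependent choice: it builds the disjoint sequences that contradict exhaustion, and the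
decreasing sequences of entourages that play the role of `ε / 2 ^ n`. -/
theorem exists_chain {C : Type*} {P : C → Prop} {R : C → C → Prop} {c₀ : C} (h₀ : P c₀)
    (h : ∀ c, P c → ∃ c', P c' ∧ R c c') :
    ∃ u : ℕ → C, u 0 = c₀ ∧ ∀ n, P (u n) ∧ R (u n) (u (n + 1)) := by
  choose next hP hR using h
  let v : ℕ → {c // P c} := fun n =>
    Nat.rec ⟨c₀, h₀⟩ (fun _ c => ⟨next c.1 c.2, hP c.1 c.2⟩) n
  exact ⟨fun n => (v n).1, rfl, fun n => ⟨(v n).2, hR (v n).1 (v n).2⟩⟩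

/-! ### Elementary closure and separation properties of a Riesz system. -/

section System

variable [UniformSpace X] [AddCommMonoid X] {𝓚 𝓖 : Set (Set S)} {𝓑 : Set (Set X)}
  {F : AddSubmonoid (S → X)} {T : UniformSpace F}

namespace IsRieszSystem

theorem K_empty (h : IsRieszSystem 𝓚 𝓖 𝓑 F T) : ∅ ∈ 𝓚 := by
  simpa using h.K_sUnion ∅ (Set.empty_subset _) Set.finite_empty

theorem K_union (h : IsRieszSystem 𝓚 𝓖 𝓑 F T) {κ κ' : Set S} (hκ : κ ∈ 𝓚) (hκ' : κ' ∈ 𝓚) :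
    κ ∪ κ' ∈ 𝓚 := by
  simpa using h.K_sUnion {κ, κ'} (Set.pair_subset hκ hκ') (Set.toFinite _)

theorem G_union (h : IsRieszSystem 𝓚 𝓖 𝓑 F T) {γ γ' : Set S} (hγ : γ ∈ 𝓖) (hγ' : γ' ∈ 𝓖) :
    γ ∪ γ' ∈ 𝓖 := by
  simpa using h.G_sUnion {γ, γ'} (Set.pair_subset hγ hγ') (Set.toFinite _)

theorem G_inter (h : IsRieszSystem 𝓚 𝓖 𝓑 F T) {γ γ' : Set S} (hγ : γ ∈ 𝓖) (hγ' : γ' ∈ 𝓖) :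
    γ ∩ γ' ∈ 𝓖 := by
  simpa using h.G_sInter {γ, γ'} (Set.pair_subset hγ hγ') (Set.toFinite _) ⟨γ, by simp⟩

theorem G_univ (h : IsRieszSystem 𝓚 𝓖 𝓑 F T) : Set.univ ∈ 𝓖 := by
  obtain ⟨H, hH, hfin, hu, -⟩ := h.partitionable 0 Set.univ univ_mem
  exact hu ▸ h.G_sUnion H hH hfin

theorem G_compl (h : IsRieszSystem 𝓚 𝓖 𝓑 F T) {κ : Set S} (hκ : κ ∈ 𝓚) : κᶜ ∈ 𝓖 := by
  simpa [Set.compl_eq_univ_sdiff] using h.G_diff_K κ hκ _ h.G_univ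

theorem exists_add (h : IsRieszSystem 𝓚 𝓖 𝓑 F T) {B : Set X} (hB : B ∈ 𝓑) :
    ∃ C ∈ 𝓑, B ⊆ C ∧ ∀ b ∈ B, ∀ b' ∈ B, b + b' ∈ C := by
  obtain ⟨C, hC, hBC⟩ := h.B_add B hB B hB
  exact ⟨C, hC, fun b hb => by simpa using hBC b hb 0 (h.zero_mem_B B hB), hBC⟩

theorem hull_mem (h : IsRieszSystem 𝓚 𝓖 𝓑 F T) (x : X) : hull 𝓑 x ∈ 𝓑 := by
  obtain ⟨B, hB, hx⟩ := h.B_cover x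
  exact h.B_sInter _ (fun _ hC => hC.1) ⟨B, hB, hx⟩

theorem zero_mem_inRange (h : IsRieszSystem 𝓚 𝓖 𝓑 F T) {B : Set X} (hB : B ∈ 𝓑) :
    (0 : F) ∈ inRange F B :=
  mem_inRange.2 fun _ => h.zero_mem_B B hB

theorem supportedBy_zero (h : IsRieszSystem 𝓚 𝓖 𝓑 F T) (α : Set S) :
    SupportedBy 𝓚 ((0 : F) : S → X) α :=
  ⟨∅, h.K_empty, Set.empty_subset _, fun _ _ => rfl⟩

theorem supportedBy_add (h : IsRieszSystem 𝓚 𝓖 𝓑 F T) {f g : F} {α β : Set S}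
    (hf : SupportedBy 𝓚 (f : S → X) α) (hg : SupportedBy 𝓚 (g : S → X) β) :
    SupportedBy 𝓚 ((f + g : F) : S → X) (α ∪ β) := by
  obtain ⟨κ, hκ, hκα, hf⟩ := hf
  obtain ⟨κ', hκ', hκβ, hg⟩ := hg
  refine ⟨κ ∪ κ', h.K_union hκ hκ', Set.union_subset_union hκα hκβ, fun s hs => ?_⟩
  have h₁ := hf s fun h' => hs (Or.inl h')
  have h₂ := hg s fun h' => hs (Or.inr h')
  simp [h₁, h₂]

theorem equalsOver_add (h : IsRieszSystem 𝓚 𝓖 𝓑 F T) {f g : F} {x y : X} {κ : Set S}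
    (hf : EqualsOver 𝓖 (f : S → X) x κ) (hg : EqualsOver 𝓖 (g : S → X) y κ) :
    EqualsOver 𝓖 ((f + g : F) : S → X) (x + y) κ := by
  obtain ⟨γ, hγ, hκγ, hf⟩ := hf
  obtain ⟨γ', hγ', hκγ', hg⟩ := hg
  refine ⟨γ ∩ γ', h.G_inter hγ hγ', Set.subset_inter hκγ hκγ', fun s hs => ?_⟩
  change (f : S → X) s + (g : S → X) s = _
  rw [hf s hs.1, hg s hs.2]

theorem exists_disjoint_nhds (h : IsRieszSystem 𝓚 𝓖 𝓑 F T) {κ κ' γ : Set S} (hκ : κ ∈ 𝓚)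
    (hκ' : κ' ∈ 𝓚) (hγ : γ ∈ 𝓖) (hd : Disjoint κ κ') (hκγ : κ ⊆ γ) (hκγ' : κ' ⊆ γ) :
    ∃ ω ∈ 𝓖, ∃ ω' ∈ 𝓖, κ ⊆ ω ∧ κ' ⊆ ω' ∧ Disjoint ω ω' ∧ ω ⊆ γ ∧ ω' ⊆ γ := by
  obtain ⟨ω, hω, κ₁, hκ₁, h₁, h₂, h₃⟩ := h.interpolate κ hκ (γ \ κ') (h.G_diff_K κ' hκ' γ hγ)
    (Set.subset_sdiff.2 ⟨hκγ, hd⟩)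
  refine ⟨ω, hω, γ \ κ₁, h.G_diff_K _ hκ₁ _ hγ, h₁, ?_, ?_, ?_, Set.sdiff_subset⟩
  · exact Set.subset_sdiff.2 ⟨hκγ', ((Set.subset_sdiff.1 h₃).2).symm⟩
  · exact Set.disjoint_left.2 fun s hs hs' => hs'.2 (h₂ hs)
  · exact (h₂.trans h₃).trans Set.sdiff_subset

end IsRieszSystem

end System

/-! ### Small sets with respect to the integral. -/

namespace IsRieszIntegral

variable [UniformSpace X] [AddCommMonoid X] [UniformSpace Z] [AddCommMonoid Z]
  {𝓚 𝓖 : Set (Set S)} {𝓑 : Set (Set X)} {F : AddSubmonoid (S → X)} {T : UniformSpace F}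
  {ℓ : F → Z}

/-- If every neighbourhood `γ` of `κ` failed, a function witnessing the failure would live on some
`κ₁ ⊆ γ \ κ`. Separating `κ` from `κ₁` leaves a smaller neighbourhood of `κ` and, disjoint from it,
a member of `𝓖` that is not small. Iteration contradicts `sBounded`. -/
theorem exists_smallOpens_diff_of_mem_K (h : IsRieszIntegral 𝓚 𝓖 𝓑 F T ℓ) {κ : Set S}
    (hκ : κ ∈ 𝓚) {γ₀ : Set S} (hγ₀ : γ₀ ∈ 𝓖) (hκγ₀ : κ ⊆ γ₀) {B : Set X} (hB : B ∈ 𝓑)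
    {W : Set (Z × Z)} (hW : W ∈ 𝓤 Z) :
    ∃ γ ∈ 𝓖, κ ⊆ γ ∧ γ ⊆ γ₀ ∧ γ \ κ ∈ smallOpens 𝓚 𝓖 ℓ B W := by
  by_contra! hcon
  have hs := h.system
  obtain ⟨u, -, hu⟩ := exists_chain (P := fun γ => γ ∈ 𝓖 ∧ κ ⊆ γ ∧ γ ⊆ γ₀)
    (R := fun γ γ' => γ' ⊆ γ ∧ ∃ G ∈ 𝓖, G ⊆ γ ∧ Disjoint G γ' ∧ G ∉ smallOpens 𝓚 𝓖 ℓ B W)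
    (c₀ := γ₀) ⟨hγ₀, hκγ₀, subset_rfl⟩ (by
      rintro γ ⟨hγ, hκγ, hγγ₀⟩
      have h₁ := hcon γ hγ hκγ hγγ₀
      have h₂ : γ \ κ ∈ 𝓖 := hs.G_diff_K κ hκ γ hγ
      simp only [smallOpens, Set.mem_ofPred_eq, not_and, not_forall] at h₁
      obtain ⟨f, hf, g, hg, ⟨κ₁, hκ₁, hκ₁γ, hgκ₁⟩, hfg⟩ := h₁ h₂
      obtain ⟨hκ₁γ, hd⟩ := Set.subset_sdiff.1 hκ₁γ
      obtain ⟨ω, hω, ω', hω', hκω, hκ₁ω', hdω, hωγ, hω'γ⟩ :=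
        hs.exists_disjoint_nhds hκ hκ₁ hγ hd.symm hκγ hκ₁γ
      exact ⟨ω, ⟨hω, hκω, hωγ.trans hγγ₀⟩, hωγ, ω', hω', hω'γ, hdω.symm,
        fun hsm => hfg (hsm.2 f hf g hg ⟨κ₁, hκ₁, hκ₁ω', hgκ₁⟩)⟩)
  choose hP hR G hG hGu hGd hGs using hu
  have hanti : Antitone u := antitone_nat_of_succ_le hR
  have hdisj : Pairwise fun i j => Disjoint (G i) (G j) := by
    refine (pairwise_disjoint_on G).2 fun i j hij => ?_
    exact (hGd i).mono_right ((hGu j).trans (hanti hij))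
  obtain ⟨m, hm⟩ := h.sBounded B hB W hW G hG hdisj
  exact hGs (m + 1) ⟨hG _, hm (m + 1) (Nat.lt_succ_self m)⟩

/-- Dual to the approximation from outside: here the inner set grows, absorbing at each stage a `κ₂`
that surrounds the support of the bad function. -/
theorem exists_smallOpens_diff_of_mem_G (h : IsRieszIntegral 𝓚 𝓖 𝓑 F T ℓ) {γ : Set S}
    (hγ : γ ∈ 𝓖) {B : Set X} (hB : B ∈ 𝓑) {W : Set (Z × Z)} (hW : W ∈ 𝓤 Z) :
    ∃ κ ∈ 𝓚, κ ⊆ γ ∧ γ \ κ ∈ smallOpens 𝓚 𝓖 ℓ B W := by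
  by_contra! hcon
  have hs := h.system
  obtain ⟨u, -, hu⟩ := exists_chain (P := fun κ => κ ∈ 𝓚 ∧ κ ⊆ γ)
    (R := fun κ κ' => κ ⊆ κ' ∧ ∃ G ∈ 𝓖, G ⊆ κ' ∧ Disjoint G κ ∧ G ∉ smallOpens 𝓚 𝓖 ℓ B W)
    (c₀ := ∅) ⟨hs.K_empty, Set.empty_subset _⟩ (by
      rintro κ ⟨hκ, hκγ⟩
      have h₁ := hcon κ hκ hκγ
      have h₂ : γ \ κ ∈ 𝓖 := hs.G_diff_K κ hκ γ hγ
      simp only [smallOpens, Set.mem_ofPred_eq, not_and, not_forall] at h₁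
      obtain ⟨f, hf, g, hg, ⟨κ₁, hκ₁, hκ₁γ, hgκ₁⟩, hfg⟩ := h₁ h₂
      obtain ⟨G, hG, κ₂, hκ₂, h₃, h₄, h₅⟩ := hs.interpolate κ₁ hκ₁ _ h₂ hκ₁γ
      obtain ⟨h₅, h₆⟩ := Set.subset_sdiff.1 h₅
      exact ⟨κ ∪ κ₂, ⟨hs.K_union hκ hκ₂, Set.union_subset hκγ h₅⟩, Set.subset_union_left,
        G, hG, h₄.trans Set.subset_union_right, h₆.mono_left h₄,
        fun hsm => hfg (hsm.2 f hf g hg ⟨κ₁, hκ₁, h₃, hgκ₁⟩)⟩)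
  choose hP hR G hG hGu hGd hGs using hu
  have hmono : Monotone u := monotone_nat_of_le_succ hR
  have hdisj : Pairwise fun i j => Disjoint (G i) (G j) := by
    refine (pairwise_disjoint_on G).2 fun i j hij => ?_
    exact ((hGd j).mono_right ((hGu i).trans (hmono hij))).symm
  obtain ⟨m, hm⟩ := h.sBounded B hB W hW G hG hdisj
  exact hGs (m + 1) ⟨hG _, hm (m + 1) (Nat.lt_succ_self m)⟩

theorem exists_entourage_map (h : IsRieszIntegral 𝓚 𝓖 𝓑 F T ℓ) {B : Set X} (hB : B ∈ 𝓑)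
    {W : Set (Z × Z)} (hW : W ∈ 𝓤 Z) :
    ∃ V ∈ 𝓤[T], ∀ f ∈ inRange F B, ∀ g ∈ inRange F B, (f, g) ∈ V → (ℓ f, ℓ g) ∈ W := by
  have h₁ := h.uniformContinuousOn B hB hW
  rw [mem_map, mem_inf_principal] at h₁
  exact ⟨_, h₁, fun f hf g hg hfg => hfg ⟨hf, hg⟩⟩

end IsRieszIntegral

theorem IsRieszSystem.exists_entourage_add [UniformSpace X] [AddCommMonoid X]
    {𝓚 𝓖 : Set (Set S)} {𝓑 : Set (Set X)} {F : AddSubmonoid (S → X)} {T : UniformSpace F}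
    (h : IsRieszSystem 𝓚 𝓖 𝓑 F T) {V : Set (F × F)} (hV : V ∈ 𝓤[T]) :
    ∃ V' ∈ 𝓤[T], ∀ b f g : F, (f, g) ∈ V' → (b + f, b + g) ∈ V := by
  obtain ⟨V', hV', h'⟩ := @exists_add_mem_uniformity F T _ ⟨h.uniform_add⟩ V hV
  exact ⟨V', hV', fun b f g hfg => h' b b f g (@refl_mem_uniformity F T b V' hV') hfg⟩

namespace IsRieszIntegral

variable [UniformSpace X] [AddCommMonoid X] [UniformSpace Z] [AddCommMonoid Z]
  {𝓚 𝓖 : Set (Set S)} {𝓑 : Set (Set X)} {F : AddSubmonoid (S → X)} {T : UniformSpace F}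
  {ℓ : F → Z}

/-- Two functions that are supported by `γ` and agree near `κ` have nearly the same integral,
provided `γ \ κ` is small. -/
theorem exists_map_add_mem (h : IsRieszIntegral 𝓚 𝓖 𝓑 F T ℓ) {W : Set (Z × Z)} (hW : W ∈ 𝓤 Z) :
    ∃ V ∈ 𝓤 Z, ∀ C ∈ 𝓑, ∀ D ∈ 𝓑, C ⊆ D → (∀ b ∈ C, ∀ c ∈ C, b + c ∈ D) →
      ∀ κ ∈ 𝓚, ∀ γ ∈ 𝓖, κ ⊆ γ → γ \ κ ∈ smallOpens 𝓚 𝓖 ℓ D V →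
      ∀ b ∈ inRange F C, ∀ f ∈ inRange F C, ∀ g ∈ inRange F C,
      SupportedBy 𝓚 (f : S → X) γ → SupportedBy 𝓚 (g : S → X) γ →
      (∃ ω ∈ 𝓖, κ ⊆ ω ∧ ∀ s ∈ ω, (f : S → X) s = (g : S → X) s) →
      (ℓ (b + f), ℓ (b + g)) ∈ W := by
  have hs := h.system
  obtain ⟨V, hV, -, hsymm, hcomp⟩ := exists_symm_comp_three hW
  refine ⟨V, hV, fun C hC D hD hCD hadd κ hκ γ hγ hκγ hsm b hb f hf g hg hfγ hgγ hω => ?_⟩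
  obtain ⟨ω, hω, hκω, hfg⟩ := hω
  -- The corrected functions `b + f + p` and `b + g + q` have range in `E`. The choices made from
  -- `E` on may depend on `C` and `D`, but `V` depends only on `W`.
  obtain ⟨E, hE, hDE, haddE⟩ := hs.exists_add hD
  obtain ⟨V₁, hV₁, h₁⟩ := h.exists_entourage_map hE hV
  obtain ⟨V₂, hV₂, h₂⟩ := hs.exists_entourage_add hV₁
  obtain ⟨U, hU, h₃⟩ := hs.extend C hC V₂ hV₂
  obtain ⟨p, hp, q, hq, hpκ, hqκ, hpq⟩ := h₃ κ hκ γ hγ hκγ f hf g hg hfγ hgγ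
    ⟨ω ∩ γ, hs.G_inter hω hγ, Set.subset_inter hκω hκγ, Set.inter_subset_right,
      fun s hsω => by rw [hfg s hsω.1]; exact refl_mem_uniformity hU⟩
  have hbf := add_mem_inRange hadd hb hf
  have hbg := add_mem_inRange hadd hb hg
  have hp' := inRange_mono hCD hp
  have hq' := inRange_mono hCD hq
  refine hcomp _ _ _ _ (hsm.2 _ hbf p hp' hpκ) (h₁ _ ?_ _ ?_ ?_)
    (hsymm _ _ (hsm.2 _ hbg q hq' hqκ))
  · exact add_mem_inRange haddE hbf hp'
  · exact add_mem_inRange haddE hbg hq'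
  · rw [add_assoc, add_assoc]
    exact h₂ b _ _ hpq

/-- A partition of unity replaces `g` by `k γ₁ + k γ₂`, whose terms live on `γ₁` and `γ₂` and can be
added to `f` one after the other. -/
theorem exists_union_mem_smallOpens (h : IsRieszIntegral 𝓚 𝓖 𝓑 F T ℓ) {W : Set (Z × Z)}
    (hW : W ∈ 𝓤 Z) :
    ∃ V ∈ 𝓤 Z, ∀ C ∈ 𝓑, ∀ D ∈ 𝓑, C ⊆ D → (∀ b ∈ C, ∀ c ∈ C, b + c ∈ D) →
      ∀ γ₁ ∈ smallOpens 𝓚 𝓖 ℓ D V, ∀ γ₂ ∈ smallOpens 𝓚 𝓖 ℓ D V,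
      γ₁ ∪ γ₂ ∈ smallOpens 𝓚 𝓖 ℓ C W := by
  classical
  have hs := h.system
  obtain ⟨V, hV, hVW, hsymm, hcomp⟩ := exists_symm_comp_three hW
  obtain ⟨V', hV', h'⟩ := h.exists_map_add_mem hV
  refine ⟨V, hV, fun C hC D hD hCD hadd γ₁ h₁ γ₂ h₂ => ?_⟩
  have hγ := hs.G_union h₁.1 h₂.1
  refine ⟨hγ, fun f hf g hg hgγ => ?_⟩
  -- For equal sets the finset `{γ₁, γ₂}` is a singleton and the partition has only one term.
  rcases eq_or_ne γ₁ γ₂ with rfl | hne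
  · rw [Set.union_self] at hgγ
    exact hVW (h₁.2 f (inRange_mono hCD hf) g (inRange_mono hCD hg) hgγ)
  obtain ⟨κ₀, hκ₀, hκ₀γ, hsm⟩ := h.exists_smallOpens_diff_of_mem_G hγ hD hV'
  have hgγ' := hgγ
  obtain ⟨κ₁, hκ₁, hκ₁γ, hgκ₁⟩ := hgγ
  have hκ := hs.K_union hκ₀ hκ₁
  have hκγ := Set.union_subset hκ₀γ hκ₁γ
  -- The partition reproduces `g` only on a member of `𝓚`, while `exists_map_add_mem` needs equality
  -- on a member of `𝓖` around `κ₀ ∪ κ₁`; hence the interpolated pair `ω ⊆ κ'`.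
  obtain ⟨ω, hω, κ', hκ', hκω, hωκ', hκ'γ⟩ := hs.interpolate _ hκ _ hγ hκγ
  obtain ⟨k, hk, hksum, hkg⟩ := hs.partition C hC {γ₁, γ₂}
    (by simpa using Set.pair_subset h₁.1 h₂.1) κ' hκ' (by simpa using hκ'γ) g hg
  obtain ⟨hk₁, hk₁γ⟩ := hk γ₁ (by simp)
  obtain ⟨hk₂, hk₂γ⟩ := hk γ₂ (by simp)
  have hsum := hksum {γ₁, γ₂} subset_rfl
  simp only [Finset.sum_pair hne] at hsum hkg
  have hsm' : (γ₁ ∪ γ₂) \ (κ₀ ∪ κ₁) ∈ smallOpens 𝓚 𝓖 ℓ D V' :=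
    smallOpens_anti hsm (hs.G_diff_K _ hκ _ hγ)
      (Set.sdiff_subset_sdiff_right Set.subset_union_left)
  have h₃ := h' C hC D hD hCD hadd _ hκ _ hγ hκγ hsm' f hf g hg (k γ₁ + k γ₂) hsum hgγ'
    (hs.supportedBy_add hk₁γ hk₂γ) ⟨ω, hω, hκω, fun s hsω => hkg s (hωκ' hsω)⟩
  refine hcomp _ _ _ _ (h₁.2 f (inRange_mono hCD hf) _ (inRange_mono hCD hk₁) hk₁γ)
    (h₂.2 _ (add_mem_inRange hadd hf hk₁) _ (inRange_mono hCD hk₂) hk₂γ) (hsymm _ _ ?_)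
  rwa [add_assoc]

end IsRieszIntegral

/-! ### The set function `τ`: existence, additivity, tightness, smallness. -/

namespace IsRieszIntegral

variable [UniformSpace X] [AddCommMonoid X] [UniformSpace Z] [AddCommMonoid Z]
  {𝓚 𝓖 : Set (Set S)} {𝓑 : Set (Set X)} {F : AddSubmonoid (S → X)} {T : UniformSpace F}
  {ℓ : F → Z}

theorem hasBasis_tauFilter (h : IsRieszIntegral 𝓚 𝓖 𝓑 F T ℓ) {κ : Set S} (x : X) :
    (tauFilter 𝓚 𝓖 𝓑 ℓ κ x).HasBasis (fun γ => γ ∈ {γ | γ ∈ 𝓖 ∧ κ ⊆ γ})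
      fun γ => ℓ '' {f | f ∈ inRange F (hull 𝓑 x) ∧
        EqualsOver 𝓖 (f : S → X) x κ ∧ SupportedBy 𝓚 (f : S → X) γ} := by
  have hs := h.system
  refine hasBasis_biInf_principal (fun γ hγ γ' hγ' => ⟨γ ∩ γ',
    ⟨hs.G_inter hγ.1 hγ'.1, Set.subset_inter hγ.2 hγ'.2⟩, ?_, ?_⟩)
    ⟨Set.univ, hs.G_univ, Set.subset_univ _⟩
  · exact Set.image_mono fun f hf => ⟨hf.1, hf.2.1, hf.2.2.mono Set.inter_subset_left⟩
  · exact Set.image_mono fun f hf => ⟨hf.1, hf.2.1, hf.2.2.mono Set.inter_subset_right⟩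

theorem tauFilter_neBot (h : IsRieszIntegral 𝓚 𝓖 𝓑 F T ℓ) {κ : Set S} (hκ : κ ∈ 𝓚) (x : X) :
    (tauFilter 𝓚 𝓖 𝓑 ℓ κ x).NeBot := by
  refine (h.hasBasis_tauFilter x).neBot_iff.2 fun {γ} hγ => ?_
  obtain ⟨f, hf, hfγ, hfκ⟩ := h.system.exists_bump κ hκ γ hγ.1 hγ.2 x
  exact ⟨ℓ f, f, ⟨hf, hfκ, hfγ⟩, rfl⟩

/-- The case `b = 0` of `exists_map_add_mem`: the integral of a bump over `κ` hardly depends on the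
bump, which is the Cauchy property behind `τ`. -/
theorem exists_map_mem_of_equalsOver (h : IsRieszIntegral 𝓚 𝓖 𝓑 F T ℓ) {W : Set (Z × Z)}
    (hW : W ∈ 𝓤 Z) :
    ∃ V ∈ 𝓤 Z, ∀ C ∈ 𝓑, ∀ D ∈ 𝓑, C ⊆ D → (∀ b ∈ C, ∀ c ∈ C, b + c ∈ D) →
      ∀ κ ∈ 𝓚, ∀ γ ∈ 𝓖, κ ⊆ γ → γ \ κ ∈ smallOpens 𝓚 𝓖 ℓ D V → ∀ x : X,
      ∀ f ∈ inRange F C, ∀ g ∈ inRange F C,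
      SupportedBy 𝓚 (f : S → X) γ → SupportedBy 𝓚 (g : S → X) γ →
      EqualsOver 𝓖 (f : S → X) x κ → EqualsOver 𝓖 (g : S → X) x κ → (ℓ f, ℓ g) ∈ W := by
  obtain ⟨V, hV, h₁⟩ := h.exists_map_add_mem hW
  refine ⟨V, hV, fun C hC D hD hCD hadd κ hκ γ hγ hκγ hsm x f hf g hg hfγ hgγ => ?_⟩
  rintro ⟨ω, hω, hκω, hfω⟩ ⟨ω', hω', hκω', hgω'⟩
  have h₂ := h₁ C hC D hD hCD hadd κ hκ γ hγ hκγ hsm 0 (h.system.zero_mem_inRange hC) f hf g hg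
    hfγ hgγ ⟨ω ∩ ω', h.system.G_inter hω hω', Set.subset_inter hκω hκω', fun s hs => by
      rw [hfω s hs.1, hgω' s hs.2]⟩
  rwa [zero_add, zero_add] at h₂

theorem tauFilter_le_principal (h : IsRieszIntegral 𝓚 𝓖 𝓑 F T ℓ) (κ : Set S) (x : X) :
    tauFilter 𝓚 𝓖 𝓑 ℓ κ x ≤ 𝓟 (closure (ℓ '' inRange F (hull 𝓑 x))) := by
  rw [le_principal_iff]
  refine (h.hasBasis_tauFilter x).mem_iff.2 ⟨Set.univ, ⟨h.system.G_univ, Set.subset_univ _⟩, ?_⟩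
  exact (Set.image_mono fun f hf => hf.1).trans subset_closure

theorem tauFilter_le_nhds_tau (h : IsRieszIntegral 𝓚 𝓖 𝓑 F T ℓ) {κ : Set S} (hκ : κ ∈ 𝓚)
    (x : X) : tauFilter 𝓚 𝓖 𝓑 ℓ κ x ≤ 𝓝 (tau 𝓚 𝓖 𝓑 ℓ κ x) := by
  have hs := h.system
  have hC := hs.hull_mem x
  obtain ⟨D, hD, hCD, hadd⟩ := hs.exists_add hC
  obtain ⟨z, -, hz⟩ := h.relComplete _ hC (tauFilter 𝓚 𝓖 𝓑 ℓ κ x)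
    ⟨h.tauFilter_neBot hκ x, fun W hW => by
      obtain ⟨V, hV, h₁⟩ := h.exists_map_mem_of_equalsOver hW
      obtain ⟨γ, hγ, hκγ, -, hsm⟩ :=
        h.exists_smallOpens_diff_of_mem_K hκ hs.G_univ (Set.subset_univ _) hD hV
      refine mem_of_superset (prod_mem_prod ((h.hasBasis_tauFilter x).mem_of_mem ⟨hγ, hκγ⟩)
        ((h.hasBasis_tauFilter x).mem_of_mem ⟨hγ, hκγ⟩)) ?_
      rintro ⟨-, -⟩ ⟨⟨f, ⟨hf, hfκ, hfγ⟩, rfl⟩, g, ⟨hg, hgκ, hgγ⟩, rfl⟩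
      exact h₁ _ hC D hD hCD hadd κ hκ γ hγ hκγ hsm x f hf g hg hfγ hgγ hfκ hgκ⟩
    (h.tauFilter_le_principal κ x)
  exact le_nhds_lim ⟨z, hz⟩

theorem tau_mem_closure (h : IsRieszIntegral 𝓚 𝓖 𝓑 F T ℓ) {κ : Set S} (hκ : κ ∈ 𝓚) (x : X) :
    tau 𝓚 𝓖 𝓑 ℓ κ x ∈ closure (ℓ '' inRange F (hull 𝓑 x)) := by
  have := h.tauFilter_neBot hκ x
  exact isClosed_closure.mem_of_tendsto (f := id) (b := tauFilter 𝓚 𝓖 𝓑 ℓ κ x)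
    (h.tauFilter_le_nhds_tau hκ x)
    (le_principal_iff.1 (h.tauFilter_le_principal κ x))

/-- Here `f` may take values in any `C` containing `x`, not only in the hull of `x`. This freedom is
what allows sums of bumps to serve as approximants. -/
theorem exists_map_tau_mem (h : IsRieszIntegral 𝓚 𝓖 𝓑 F T ℓ) {W : Set (Z × Z)} (hW : W ∈ 𝓤 Z) :
    ∃ V ∈ 𝓤 Z, ∀ C ∈ 𝓑, ∀ D ∈ 𝓑, C ⊆ D → (∀ b ∈ C, ∀ c ∈ C, b + c ∈ D) →
      ∀ κ ∈ 𝓚, ∀ γ ∈ 𝓖, κ ⊆ γ → γ \ κ ∈ smallOpens 𝓚 𝓖 ℓ D V →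
      ∀ x ∈ C, ∀ f ∈ inRange F C, SupportedBy 𝓚 (f : S → X) γ →
      EqualsOver 𝓖 (f : S → X) x κ → (tau 𝓚 𝓖 𝓑 ℓ κ x, ℓ f) ∈ W := by
  obtain ⟨V, hV, -, hsymm, hcomp⟩ := exists_symm_comp_three hW
  obtain ⟨V', hV', h₁⟩ := h.exists_map_mem_of_equalsOver hV
  refine ⟨V', hV', fun C hC D hD hCD hadd κ hκ γ hγ hκγ hsm x hx f hf hfγ hfκ => ?_⟩
  have := h.tauFilter_neBot hκ x
  obtain ⟨-, h₂, g, ⟨hg, hgκ, hgγ⟩, rfl⟩ := this.nonempty_of_mem (inter_mem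
    (h.tauFilter_le_nhds_tau hκ x (UniformSpace.ball_mem_nhds _ hV))
    ((h.hasBasis_tauFilter x).mem_of_mem ⟨hγ, hκγ⟩))
  exact hcomp _ _ _ _ h₂ (h₁ C hC D hD hCD hadd κ hκ γ hγ hκγ hsm x g
    (inRange_mono (hull_subset hC hx) hg) f hf hgγ hfγ hgκ hfκ) (refl_mem_uniformity hV)

theorem tau_zero [T2Space Z] (h : IsRieszIntegral 𝓚 𝓖 𝓑 F T ℓ) {κ : Set S} (hκ : κ ∈ 𝓚) :
    tau 𝓚 𝓖 𝓑 ℓ κ 0 = 0 := by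
  have hs := h.system
  refine eq_of_forall_mem_uniformity fun W hW => ?_
  obtain ⟨V, hV, h₁⟩ := h.exists_map_tau_mem hW
  have hC := hs.hull_mem 0
  obtain ⟨D, hD, hCD, hadd⟩ := hs.exists_add hC
  obtain ⟨γ, hγ, hκγ, -, hsm⟩ :=
    h.exists_smallOpens_diff_of_mem_K hκ hs.G_univ (Set.subset_univ _) hD hV
  have h₂ := h₁ _ hC D hD hCD hadd κ hκ γ hγ hκγ hsm 0 (mem_hull _ _) 0 (hs.zero_mem_inRange hC)
    (hs.supportedBy_zero γ) ⟨γ, hγ, hκγ, fun _ _ => rfl⟩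
  rwa [h.map_zero] at h₂

theorem tau_empty [T2Space Z] (h : IsRieszIntegral 𝓚 𝓖 𝓑 F T ℓ) (x : X) : tau 𝓚 𝓖 𝓑 ℓ ∅ x = 0 := by
  have hs := h.system
  refine eq_of_forall_mem_uniformity fun W hW => ?_
  obtain ⟨V, hV, h₁⟩ := h.exists_map_tau_mem hW
  have hC := hs.hull_mem x
  obtain ⟨D, hD, hCD, hadd⟩ := hs.exists_add hC
  obtain ⟨γ, hγ, hκγ, -, hsm⟩ :=
    h.exists_smallOpens_diff_of_mem_K hs.K_empty hs.G_univ (Set.subset_univ _) hD hV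
  -- Over `∅` the zero function equals every `x`, because it does so vacuously on `∅ ∈ 𝓖`.
  have h₂ := h₁ _ hC D hD hCD hadd ∅ hs.K_empty γ hγ hκγ hsm x (mem_hull _ _) 0
    (hs.zero_mem_inRange hC) (hs.supportedBy_zero γ)
    ⟨∅, by simpa using hs.G_diff_K _ hs.K_empty _ (hs.G_sUnion ∅ (Set.empty_subset _)
      Set.finite_empty), subset_rfl, fun s hs' => hs'.elim⟩
  rwa [h.map_zero] at h₂

/-- Bumps with disjoint supports in `𝓖` add up to a bump over the union whose range stays in the
hull of `x`, and `ℓ` is additive on them. -/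
theorem tau_union [T2Space Z] [IsUniformAddCommMonoid Z]
    (h : IsRieszIntegral 𝓚 𝓖 𝓑 F T ℓ) {κ₁ κ₂ : Set S} (hκ₁ : κ₁ ∈ 𝓚)
    (hκ₂ : κ₂ ∈ 𝓚) (hd : Disjoint κ₁ κ₂) (x : X) :
    tau 𝓚 𝓖 𝓑 ℓ (κ₁ ∪ κ₂) x = tau 𝓚 𝓖 𝓑 ℓ κ₁ x + tau 𝓚 𝓖 𝓑 ℓ κ₂ x := by
  have hs := h.system
  refine eq_of_forall_mem_uniformity fun W hW => ?_
  obtain ⟨W₁, hW₁, -, hsymm, hcomp⟩ := exists_symm_comp_three hW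
  obtain ⟨W₂, hW₂, hadd₂⟩ := exists_add_mem_uniformity hW₁
  obtain ⟨V, hV, h₁⟩ := h.exists_map_tau_mem (inter_mem hW₁ hW₂)
  have hC := hs.hull_mem x
  have hx := mem_hull 𝓑 x
  obtain ⟨D, hD, hCD, hadd⟩ := hs.exists_add hC
  have hκ := hs.K_union hκ₁ hκ₂
  obtain ⟨γ, hγ, hκγ, -, hsm⟩ :=
    h.exists_smallOpens_diff_of_mem_K hκ hs.G_univ (Set.subset_univ _) hD hV
  obtain ⟨ω₁, hω₁, ω₂, hω₂, hκω₁, hκω₂, hdω, hωγ₁, hωγ₂⟩ := hs.exists_disjoint_nhds hκ₁ hκ₂ hγ hd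
    (Set.subset_union_left.trans hκγ) (Set.subset_union_right.trans hκγ)
  obtain ⟨γ₁, hγ₁, hκγ₁, hγω₁, hsm₁⟩ :=
    h.exists_smallOpens_diff_of_mem_K hκ₁ hω₁ hκω₁ hD hV
  obtain ⟨γ₂, hγ₂, hκγ₂, hγω₂, hsm₂⟩ :=
    h.exists_smallOpens_diff_of_mem_K hκ₂ hω₂ hκω₂ hD hV
  have hdγ : Disjoint γ₁ γ₂ := (hdω.mono_left hγω₁).mono_right hγω₂
  obtain ⟨f, hf, hfγ, hfκ⟩ := hs.exists_bump κ₁ hκ₁ γ₁ hγ₁ hκγ₁ x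
  obtain ⟨g, hg, hgγ, hgκ⟩ := hs.exists_bump κ₂ hκ₂ γ₂ hγ₂ hκγ₂ x
  have e₁ := h₁ _ hC D hD hCD hadd κ₁ hκ₁ γ₁ hγ₁ hκγ₁ hsm₁ x hx f hf hfγ hfκ
  have e₂ := h₁ _ hC D hD hCD hadd κ₂ hκ₂ γ₂ hγ₂ hκγ₂ hsm₂ x hx g hg hgγ hgκ
  have hfg : SupportedBy 𝓚 ((f + g : F) : S → X) γ := (hs.supportedBy_add hfγ hgγ).mono
    (Set.union_subset (hγω₁.trans hωγ₁) (hγω₂.trans hωγ₂))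
  have heq : EqualsOver 𝓖 ((f + g : F) : S → X) x (κ₁ ∪ κ₂) := by
    obtain ⟨δ₁, hδ₁, hκδ₁, hfδ⟩ := hfκ
    obtain ⟨δ₂, hδ₂, hκδ₂, hgδ⟩ := hgκ
    -- Intersecting with `γ₁` and `γ₂` makes the other summand vanish on each piece.
    refine ⟨δ₁ ∩ γ₁ ∪ δ₂ ∩ γ₂, hs.G_union (hs.G_inter hδ₁ hγ₁) (hs.G_inter hδ₂ hγ₂),
      Set.union_subset_union (Set.subset_inter hκδ₁ hκγ₁) (Set.subset_inter hκδ₂ hκγ₂), ?_⟩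
    rintro s (⟨h₃, h₄⟩ | ⟨h₃, h₄⟩)
    · change (f : S → X) s + (g : S → X) s = x
      rw [hfδ s h₃, hgγ.eq_zero (Set.disjoint_left.1 hdγ h₄), add_zero]
    · change (f : S → X) s + (g : S → X) s = x
      rw [hgδ s h₃, hfγ.eq_zero (Set.disjoint_right.1 hdγ h₄), zero_add]
  have e := h₁ _ hC D hD hCD hadd _ hκ γ hγ hκγ hsm x hx (f + g)
    (add_mem_inRange_of_disjoint hdγ hf hg hfγ hgγ) hfg heq
  rw [h.map_add f g (separated_of_disjoint hγ₁ hγ₂ hdγ hfγ hgγ)] at e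
  exact hcomp _ _ _ _ e.1 (hsymm _ _ (hadd₂ _ _ _ _ e₁.2 e₂.2)) (refl_mem_uniformity hW₁)

/-- Choose a thin neighbourhood `ω` of `κ` and take `κ₁ = κ' \ ω`. A bump over `κ'` is also a bump
over `κ ∪ κ₁`, so its integral approximates both sides. -/
theorem exists_tau_add_mem [T2Space Z] [IsUniformAddCommMonoid Z] (h : IsRieszIntegral 𝓚 𝓖 𝓑 F T ℓ)
    {κ κ' : Set S} (hκ : κ ∈ 𝓚) (hκ' : κ' ∈ 𝓚) (hκκ' : κ ⊆ κ') {B : Set X} (hB : B ∈ 𝓑)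
    {W : Set (Z × Z)} (hW : W ∈ 𝓤 Z) :
    ∃ κ₁ ∈ 𝓚, κ₁ ⊆ κ' \ κ ∧ ∀ x ∈ B,
      (tau 𝓚 𝓖 𝓑 ℓ κ' x, tau 𝓚 𝓖 𝓑 ℓ κ x + tau 𝓚 𝓖 𝓑 ℓ κ₁ x) ∈ W := by
  have hs := h.system
  obtain ⟨W₁, hW₁, -, hsymm, hcomp⟩ := exists_symm_comp_three hW
  obtain ⟨V, hV, h₁⟩ := h.exists_map_tau_mem hW₁
  obtain ⟨V', hV', h₂⟩ := h.exists_union_mem_smallOpens hV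
  obtain ⟨D, hD, hBD, haddD⟩ := hs.exists_add hB
  obtain ⟨E, hE, hDE, haddE⟩ := hs.exists_add hD
  obtain ⟨γ, hγ, hκγ, -, hsm⟩ := h.exists_smallOpens_diff_of_mem_K hκ' hs.G_univ
    (Set.subset_univ _) hE (inter_mem hV hV')
  obtain ⟨ω, hω, hκω, -, hsm'⟩ := h.exists_smallOpens_diff_of_mem_K hκ hs.G_univ
    (Set.subset_univ _) hE hV'
  have hκ₁ := hs.K_diff_G κ' hκ' ω hω
  have hu := hs.K_union hκ hκ₁
  have huκ' : κ ∪ κ' \ ω ⊆ κ' := Set.union_subset hκκ' Set.sdiff_subset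
  have hsm₁ := smallOpens_mono (C := E) (B := D) hDE Set.inter_subset_left hsm
  -- This difference is covered by `γ \ κ'` and `ω \ κ`, both of which are small.
  have hsm₂ : γ \ (κ ∪ κ' \ ω) ∈ smallOpens 𝓚 𝓖 ℓ D V := by
    refine smallOpens_anti (h₂ D hD E hE hDE haddE _
      (smallOpens_mono subset_rfl Set.inter_subset_right hsm) _ hsm') (hs.G_diff_K _ hu _ hγ) ?_
    rintro s ⟨hsγ, hs'⟩
    by_cases h₃ : s ∈ κ'
    · exact Or.inr ⟨by_contra fun h₄ => hs' (Or.inr ⟨h₃, h₄⟩), fun h₄ => hs' (Or.inl h₄)⟩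
    · exact Or.inl ⟨hsγ, h₃⟩
  refine ⟨κ' \ ω, hκ₁, fun s hs' => ⟨hs'.1, fun h' => hs'.2 (hκω h')⟩, fun x hx => ?_⟩
  obtain ⟨f, hf, hfγ, hfκ⟩ := hs.exists_bump κ' hκ' γ hγ hκγ x
  have hf' := inRange_mono (hull_subset hB hx) hf
  have e₁ := h₁ B hB D hD hBD haddD κ' hκ' γ hγ hκγ hsm₁ x hx f hf' hfγ hfκ
  have e₂ := h₁ B hB D hD hBD haddD _ hu γ hγ (huκ'.trans hκγ) hsm₂ x hx f hf' hfγ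
    (hfκ.mono huκ')
  rw [h.tau_union hκ hκ₁ (Set.disjoint_left.2 fun s h₃ h₄ => h₄.2 (hκω h₃))] at e₂
  exact hcomp _ _ _ _ e₁ (hsymm _ _ e₂) (refl_mem_uniformity hW₁)

/-- The bumps over different members of `K` have disjoint supports, so `f` and `g` keep their ranges
in `B` however large `K` is. The same `f` serves both sums, which matches the form of smallness for
`ℓ`. -/
theorem exists_sum_tau_mem [IsUniformAddCommMonoid Z] (h : IsRieszIntegral 𝓚 𝓖 𝓑 F T ℓ)
    {B : Set X} (hB : B ∈ 𝓑) {x y : Set S → X} (K : Finset (Set S)) {W : Set (Z × Z)}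
    (hW : W ∈ 𝓤 Z) {γ : Set S} (hγ : γ ∈ 𝓖) (hK : (K : Set (Set S)) ⊆ 𝓚)
    (hd : (K : Set (Set S)).PairwiseDisjoint id) (hKγ : ⋃₀ (K : Set (Set S)) ⊆ γ)
    (hx : ∀ κ ∈ K, x κ ∈ B) (hy : ∀ κ ∈ K, y κ ∈ B) :
    ∃ f ∈ inRange F B, ∃ g ∈ inRange F B,
      SupportedBy 𝓚 (f : S → X) γ ∧ SupportedBy 𝓚 (g : S → X) γ ∧
      (∑ κ ∈ K, tau 𝓚 𝓖 𝓑 ℓ κ (x κ), ℓ f) ∈ W ∧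
      (∑ κ ∈ K, tau 𝓚 𝓖 𝓑 ℓ κ (x κ + y κ), ℓ (f + g)) ∈ W := by
  classical
  have hs := h.system
  induction K using Finset.induction_on generalizing W γ with
  | empty =>
    refine ⟨0, hs.zero_mem_inRange hB, 0, hs.zero_mem_inRange hB, hs.supportedBy_zero γ,
      hs.supportedBy_zero γ, ?_, ?_⟩
    · simpa [h.map_zero] using refl_mem_uniformity hW
    · simpa [h.map_zero] using refl_mem_uniformity hW
  | insert κ K hκK ih =>
    rw [Finset.coe_insert] at hK hd hKγ
    obtain ⟨hκ, hK⟩ := Set.insert_subset_iff.1 hK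
    rw [Set.sUnion_insert, Set.union_subset_iff] at hKγ
    have hKu : ⋃₀ (K : Set (Set S)) ∈ 𝓚 := hs.K_sUnion _ hK K.finite_toSet
    have hκd : Disjoint κ (⋃₀ (K : Set (Set S))) := by
      refine Set.disjoint_sUnion_right.2 fun κ' hκ' => ?_
      exact hd (Set.mem_insert _ _) (Set.mem_insert_of_mem _ hκ')
        (fun h' => hκK (h' ▸ Finset.mem_coe.1 hκ'))
    obtain ⟨ω, hω, ω', hω', hκω, hKω', hdω, hωγ, hωγ'⟩ :=
      hs.exists_disjoint_nhds hκ hKu hγ hκd hKγ.1 hKγ.2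
    obtain ⟨W₁, hW₁, haddW⟩ := exists_add_mem_uniformity hW
    obtain ⟨f, hf, g, hg, hfω, hgω, hfW, hgW⟩ := ih hW₁ hω' hK
      (hd.subset (Set.subset_insert _ _)) hKω' (fun κ' hκ' => hx κ' (Finset.mem_insert_of_mem hκ'))
      (fun κ' hκ' => hy κ' (Finset.mem_insert_of_mem hκ'))
    obtain ⟨V, hV, h₁⟩ := h.exists_map_tau_mem hW₁
    -- `C` accommodates `x κ + y κ` and the range of `f₀ + g₀`; `D` is the further enlargement
    -- required by `exists_map_tau_mem`.
    obtain ⟨C, hC, hBC, haddC⟩ := hs.exists_add hB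
    obtain ⟨D, hD, hCD, haddD⟩ := hs.exists_add hC
    obtain ⟨δ, hδ, hκδ, hδω, hsm⟩ := h.exists_smallOpens_diff_of_mem_K hκ hω hκω hD hV
    have hxB := hx κ (Finset.mem_insert_self _ _)
    have hyB := hy κ (Finset.mem_insert_self _ _)
    obtain ⟨f₀, hf₀, hf₀δ, hf₀κ⟩ := hs.exists_bump κ hκ δ hδ hκδ (x κ)
    obtain ⟨g₀, hg₀, hg₀δ, hg₀κ⟩ := hs.exists_bump κ hκ δ hδ hκδ (y κ)
    replace hf₀ := inRange_mono (hull_subset hB hxB) hf₀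
    replace hg₀ := inRange_mono (hull_subset hB hyB) hg₀
    have hfg₀δ := (hs.supportedBy_add hf₀δ hg₀δ).mono (Set.union_self δ).subset
    have e₁ := h₁ C hC D hD hCD haddD κ hκ δ hδ hκδ hsm _ (hBC hxB) f₀ (inRange_mono hBC hf₀)
      hf₀δ hf₀κ
    have e₂ := h₁ C hC D hD hCD haddD κ hκ δ hδ hκδ hsm _ (haddC _ hxB _ hyB) (f₀ + g₀)
      (add_mem_inRange haddC hf₀ hg₀) hfg₀δ (hs.equalsOver_add hf₀κ hg₀κ)
    have hfgω := (hs.supportedBy_add hfω hgω).mono (Set.union_self ω').subset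
    have hdδ : Disjoint δ ω' := hdω.mono_left hδω
    have hsub : δ ∪ ω' ⊆ γ := Set.union_subset (hδω.trans hωγ) hωγ'
    refine ⟨f₀ + f, add_mem_inRange_of_disjoint hdδ hf₀ hf hf₀δ hfω,
      g₀ + g, add_mem_inRange_of_disjoint hdδ hg₀ hg hg₀δ hgω,
      (hs.supportedBy_add hf₀δ hfω).mono hsub, (hs.supportedBy_add hg₀δ hgω).mono hsub, ?_, ?_⟩
    · rw [Finset.sum_insert hκK, h.map_add _ _ (separated_of_disjoint hδ hω' hdδ hf₀δ hfω)]
      exact haddW _ _ _ _ e₁ hfW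
    · rw [Finset.sum_insert hκK, add_add_add_comm,
        h.map_add _ _ (separated_of_disjoint hδ hω' hdδ hfg₀δ hfgω)]
      exact haddW _ _ _ _ e₂ hgW

theorem exists_smallForMeasure_tau [IsUniformAddCommMonoid Z]
    (h : IsRieszIntegral 𝓚 𝓖 𝓑 F T ℓ) {W : Set (Z × Z)} (hW : W ∈ 𝓤 Z) :
    ∃ V ∈ 𝓤 Z, ∀ B ∈ 𝓑, ∀ α, SmallFor 𝓚 𝓖 ℓ B V α →
      SmallForMeasure 𝓚 𝓖 (tau 𝓚 𝓖 𝓑 ℓ) B W α := by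
  obtain ⟨V, hV, -, hsymm, hcomp⟩ := exists_symm_comp_three hW
  refine ⟨V, hV, fun B hB α => ?_⟩
  rintro ⟨γ, hγ, hαγ⟩
  refine ⟨γ, hγ.1, hαγ, fun K hK hd hKγ x y hx hy => ?_⟩
  obtain ⟨f, hf, g, hg, hfγ, hgγ, hfW, hgW⟩ := h.exists_sum_tau_mem hB K hV hγ.1 hK hd hKγ hx hy
  exact hcomp _ _ _ _ hfW (hγ.2 f hf g hg hgγ) (hsymm _ _ hgW)

end IsRieszIntegral

/-! ### Convergence criteria and smallness for set functions. -/

theorem exists_tendsto_of_isComplete [UniformSpace Z] {ι : Type*} {l : Filter ι} [l.NeBot]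
    {u : ι → Z} {C : Set Z} (hC : IsComplete C) (hu : ∀ i, u i ∈ C)
    (h : ∀ W ∈ 𝓤 Z, ∃ a, ∀ᶠ i in l, (a, u i) ∈ W) : ∃ z ∈ C, Tendsto u l (𝓝 z) := by
  refine hC (map u l) ⟨inferInstance, fun W hW => ?_⟩
    (le_principal_iff.2 (mem_map.2 (univ_mem' hu)))
  obtain ⟨V, hV, -, hsymm, hcomp⟩ := exists_symm_comp_three hW
  obtain ⟨a, ha⟩ := h V hV
  refine mem_of_superset (prod_mem_prod (image_mem_map ha) (image_mem_map ha)) ?_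
  rintro ⟨-, -⟩ ⟨⟨i, hi, rfl⟩, j, hj, rfl⟩
  exact hcomp _ _ _ _ (hsymm _ _ hi) hj (refl_mem_uniformity hV)

theorem mem_of_eventually_mem_of_tendsto [UniformSpace Z] {ι : Type*} {l : Filter ι} [l.NeBot]
    {u : ι → Z} {a z : Z} {V W : Set (Z × Z)} (hV : V ∈ 𝓤 Z)
    (hsymm : ∀ a b, (a, b) ∈ V → (b, a) ∈ V)
    (hcomp : ∀ a b c d, (a, b) ∈ V → (b, c) ∈ V → (c, d) ∈ V → (a, d) ∈ W)
    (hu : Tendsto u l (𝓝 z)) (h : ∀ᶠ i in l, (a, u i) ∈ V) : (a, z) ∈ W := by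
  obtain ⟨i, h₁, h₂⟩ := (h.and (hu (UniformSpace.ball_mem_nhds z hV))).exists
  exact hcomp _ _ _ _ h₁ (hsymm _ _ h₂) (refl_mem_uniformity hV)

section Small

variable [AddCommMonoid X] [AddCommMonoid Z] {𝓚 𝓖 : Set (Set S)} {τ : Set S → X → Z}

theorem SmallForMeasure.anti {B : Set X} {W : Set (Z × Z)} {α β : Set S}
    (h : SmallForMeasure 𝓚 𝓖 τ B W β) (hαβ : α ⊆ β) : SmallForMeasure 𝓚 𝓖 τ B W α :=
  let ⟨γ, hγ, hβγ, hW⟩ := h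
  ⟨γ, hγ, hαβ.trans hβγ, hW⟩

theorem SmallForMeasure.mono {B : Set X} {V W : Set (Z × Z)} {α : Set S}
    (h : SmallForMeasure 𝓚 𝓖 τ B V α) (hVW : V ⊆ W) : SmallForMeasure 𝓚 𝓖 τ B W α :=
  let ⟨γ, hγ, hαγ, hV⟩ := h
  ⟨γ, hγ, hαγ, fun K hK hd hKγ x y hx hy => hVW (hV K hK hd hKγ x y hx hy)⟩

theorem smallForMeasure_congr {σ : Set S → X → Z} (h : ∀ κ ∈ 𝓚, σ κ = τ κ) {B : Set X}
    {W : Set (Z × Z)} {α : Set S} :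
    SmallForMeasure 𝓚 𝓖 σ B W α ↔ SmallForMeasure 𝓚 𝓖 τ B W α := by
  have key : ∀ (K : Finset (Set S)), (K : Set (Set S)) ⊆ 𝓚 → ∀ x : Set S → X,
      ∑ κ ∈ K, σ κ (x κ) = ∑ κ ∈ K, τ κ (x κ) := fun K hK x =>
    Finset.sum_congr rfl fun κ hκ => by rw [h κ (hK hκ)]
  constructor
  · rintro ⟨γ, hγ, hαγ, hW⟩
    refine ⟨γ, hγ, hαγ, fun K hK hd hKγ x y hx hy => ?_⟩
    rw [← key K hK, ← key K hK fun κ => x κ + y κ]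
    exact hW K hK hd hKγ x y hx hy
  · rintro ⟨γ, hγ, hαγ, hW⟩
    refine ⟨γ, hγ, hαγ, fun K hK hd hKγ x y hx hy => ?_⟩
    rw [key K hK, key K hK fun κ => x κ + y κ]
    exact hW K hK hd hKγ x y hx hy

/-- Since `ν` and `τ` agree on `𝓚`, this allows the regular sets of `ν` to be studied through `τ`.
-/
theorem regularSets_congr [UniformSpace Z] {𝓑 : Set (Set X)} {σ : Set S → X → Z}
    (h : ∀ κ ∈ 𝓚, σ κ = τ κ) :
    regularSets 𝓚 𝓖 𝓑 σ = regularSets 𝓚 𝓖 𝓑 τ := by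
  simp only [regularSets, smallForMeasure_congr h]

end Small

/-! ### Tight contents: stability of small sets and exhaustion. -/

section Content

variable [UniformSpace X] [AddCommMonoid X] [UniformSpace Z] [AddCommMonoid Z]
  {𝓚 𝓖 : Set (Set S)} {𝓑 : Set (Set X)} {F : AddSubmonoid (S → X)} {T : UniformSpace F}
  {τ : Set S → X → Z}

variable (𝓚 𝓖 𝓑 F T τ) in
/-- An additive, tight and regular set function on `𝓚` that is exhaustive on `𝓖` and has relatively
complete range. -/
structure IsTightContent : Prop where
  system : IsRieszSystem 𝓚 𝓖 𝓑 F T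
  map_zero : ∀ κ ∈ 𝓚, τ κ 0 = 0
  map_empty : ∀ x, τ ∅ x = 0
  map_union : ∀ κ₁ ∈ 𝓚, ∀ κ₂ ∈ 𝓚, Disjoint κ₁ κ₂ → ∀ x, τ (κ₁ ∪ κ₂) x = τ κ₁ x + τ κ₂ x
  tight : ∀ κ ∈ 𝓚, ∀ κ' ∈ 𝓚, κ ⊆ κ' → ∀ B ∈ 𝓑, ∀ W ∈ 𝓤 Z,
    ∃ κ₁ ∈ 𝓚, κ₁ ⊆ κ' \ κ ∧ ∀ x ∈ B, (τ κ' x, τ κ x + τ κ₁ x) ∈ W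
  outer : ∀ κ ∈ 𝓚, ∀ B ∈ 𝓑, ∀ W ∈ 𝓤 Z,
    ∃ γ ∈ 𝓖, κ ⊆ γ ∧ SmallForMeasure 𝓚 𝓖 τ B W (γ \ κ)
  inner : ∀ γ ∈ 𝓖, ∀ B ∈ 𝓑, ∀ W ∈ 𝓤 Z,
    ∃ κ ∈ 𝓚, κ ⊆ γ ∧ SmallForMeasure 𝓚 𝓖 τ B W (γ \ κ)
  exhaustive : ∀ B ∈ 𝓑, ∀ W ∈ 𝓤 Z, ∀ γ : ℕ → Set S, (∀ n, γ n ∈ 𝓖) →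
    Pairwise (fun i j => Disjoint (γ i) (γ j)) →
    ∃ m : ℕ, ∀ n > m, SmallForMeasure 𝓚 𝓖 τ B W (γ n)
  complete : ∀ x, ∃ C : Set Z, IsComplete C ∧ ∀ κ ∈ 𝓚, τ κ x ∈ C

namespace IsTightContent

/-- Smallness is tested on finsets of sets, whereas the arguments use indexed families. Only empty
members of a disjoint family can repeat, and they contribute zero, so they are dropped before
reindexing. -/
theorem sum_mem (h : IsTightContent 𝓚 𝓖 𝓑 F T τ) {B : Set X} {W : Set (Z × Z)} {γ : Set S}
    (hW : ∀ K : Finset (Set S), (K : Set (Set S)) ⊆ 𝓚 →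
      (K : Set (Set S)).PairwiseDisjoint id → ⋃₀ (K : Set (Set S)) ⊆ γ →
      ∀ x y : Set S → X, (∀ κ ∈ K, x κ ∈ B) → (∀ κ ∈ K, y κ ∈ B) →
        (∑ κ ∈ K, τ κ (x κ), ∑ κ ∈ K, τ κ (x κ + y κ)) ∈ W)
    {ι : Type*} [Nonempty ι] (s : Finset ι) {κ : ι → Set S} (hκ : ∀ i ∈ s, κ i ∈ 𝓚)
    (hd : (s : Set ι).PairwiseDisjoint κ) (hκγ : ∀ i ∈ s, κ i ⊆ γ) {x y : ι → X}
    (hx : ∀ i ∈ s, x i ∈ B) (hy : ∀ i ∈ s, y i ∈ B) :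
    (∑ i ∈ s, τ (κ i) (x i), ∑ i ∈ s, τ (κ i) (x i + y i)) ∈ W := by
  classical
  set t := s.filter fun i => (κ i).Nonempty with ht
  have hts : t ⊆ s := Finset.filter_subset _ _
  have hinj : Set.InjOn κ (t : Set ι) := by
    intro i hi j hj hij
    by_contra hne
    have h₁ := hd (Finset.mem_coe.2 (hts hi)) (Finset.mem_coe.2 (hts hj)) hne
    rw [Function.onFun, ← hij, disjoint_self] at h₁
    exact (Finset.mem_filter.1 (Finset.mem_coe.1 hi)).2.ne_empty h₁
  have hsum : ∀ z : ι → X, ∑ i ∈ s, τ (κ i) (z i) = ∑ A ∈ t.image κ,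
      τ A (z (Function.invFunOn κ t A)) := by
    intro z
    rw [Finset.sum_image fun i hi j hj => hinj hi hj, ht, Finset.sum_filter, ← ht]
    refine Finset.sum_congr rfl fun i hi => ?_
    split_ifs with hne
    · rw [hinj.leftInvOn_invFunOn (Finset.mem_coe.2 (Finset.mem_filter.2 ⟨hi, hne⟩))]
    · rw [Set.not_nonempty_iff_eq_empty.1 hne, h.map_empty]
  rw [hsum x, hsum fun i => x i + y i]
  have hmem : ∀ A ∈ t.image κ, Function.invFunOn κ t A ∈ s := fun A hA =>
    hts (Finset.mem_coe.1 (Function.invFunOn_mem (by simpa using hA)))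
  refine hW _ ?_ ?_ ?_ (fun A => x (Function.invFunOn κ t A)) (fun A => y (Function.invFunOn κ t A))
    (fun A hA => hx _ (hmem A hA)) (fun A hA => hy _ (hmem A hA))
  · rw [Finset.coe_image]
    rintro - ⟨i, hi, rfl⟩
    exact hκ i (hts hi)
  · rw [Finset.coe_image]
    rintro - ⟨i, hi, rfl⟩ - ⟨j, hj, rfl⟩ hne
    exact hd (Finset.mem_coe.2 (hts hi)) (Finset.mem_coe.2 (hts hj)) fun hij => hne (hij ▸ rfl)
  · rw [Finset.coe_image]
    refine Set.sUnion_subset ?_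
    rintro - ⟨i, hi, rfl⟩
    exact hκγ i (hts hi)

theorem smallForMeasure_empty (h : IsTightContent 𝓚 𝓖 𝓑 F T τ) {B : Set X} {W : Set (Z × Z)}
    (hW : W ∈ 𝓤 Z) : SmallForMeasure 𝓚 𝓖 τ B W ∅ := by
  refine ⟨∅, by simpa using h.system.G_sUnion ∅ (Set.empty_subset _) Set.finite_empty, subset_rfl,
    fun K hK hd hKe x y hx hy => ?_⟩
  have h₀ : ∀ κ ∈ K, ∀ x, τ κ x = 0 := fun κ hκ x => by
    rw [Set.subset_empty_iff.1 ((Set.subset_sUnion_of_mem (Finset.mem_coe.2 hκ)).trans hKe),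
      h.map_empty]
  rw [Finset.sum_eq_zero fun κ hκ => h₀ κ hκ _, Finset.sum_eq_zero fun κ hκ => h₀ κ hκ _]
  exact refl_mem_uniformity hW

/-- The analogue of summing `2 ^ (-i)`: the total error is bounded by `w k`, independently of the
number `n` of sets. -/
theorem smallForMeasure_iUnion (h : IsTightContent 𝓚 𝓖 𝓑 F T τ) {w : ℕ → Set (Z × Z)}
    (hw : ∀ n, w n ∈ 𝓤 Z) {B : Set X}
    (hunion : ∀ n α β, SmallForMeasure 𝓚 𝓖 τ B (w (n + 1)) α →
      SmallForMeasure 𝓚 𝓖 τ B (w (n + 1)) β → SmallForMeasure 𝓚 𝓖 τ B (w n) (α ∪ β))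
    (n k : ℕ) {α : ℕ → Set S} (hα : ∀ i, SmallForMeasure 𝓚 𝓖 τ B (w (k + i + 1)) (α i)) :
    SmallForMeasure 𝓚 𝓖 τ B (w k) (⋃ i < n, α i) := by
  induction n generalizing k α with
  | zero => simpa using h.smallForMeasure_empty (hw k)
  | succ n ih =>
    rw [Set.biUnion_lt_succ']
    refine hunion k _ _ (hα 0) (ih (k + 1) fun i => ?_)
    have := hα (i + 1)
    rwa [show k + (i + 1) + 1 = k + 1 + i + 1 by omega] at this

variable [IsUniformAddCommMonoid Z]

/-- Each `κ ⊆ γ₁ ∪ γ₂` splits, up to a tightness error, into `κ \ γ₂ ⊆ γ₁` and a piece inside `κ ∩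
γ₂`. -/
theorem exists_smallForMeasure_union (h : IsTightContent 𝓚 𝓖 𝓑 F T τ) {W : Set (Z × Z)}
    (hW : W ∈ 𝓤 Z) :
    ∃ V ∈ 𝓤 Z, ∀ B ∈ 𝓑, ∀ α β, SmallForMeasure 𝓚 𝓖 τ B V α → SmallForMeasure 𝓚 𝓖 τ B V β →
      SmallForMeasure 𝓚 𝓖 τ B W (α ∪ β) := by
  have hs := h.system
  obtain ⟨W₁, hW₁, -, hsymm, hcomp⟩ := exists_symm_comp_three hW
  obtain ⟨V, hV, hadd⟩ := exists_add_mem_uniformity hW₁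
  refine ⟨V, hV, fun B hB α β => ?_⟩
  rintro ⟨γ₁, hγ₁, hαγ, h₁⟩ ⟨γ₂, hγ₂, hβγ, h₂⟩
  refine ⟨γ₁ ∪ γ₂, hs.G_union hγ₁ hγ₂, Set.union_subset_union hαγ hβγ,
    fun K hK hd hKγ x y hx hy => ?_⟩
  obtain ⟨C, hC, hBC, haddC⟩ := hs.exists_add hB
  -- `V'` may depend on `K`, because it only controls the tightness errors; `V` is fixed beforehand.
  obtain ⟨V', hV', hsum⟩ := exists_sum_mem_uniformity K hW₁
  have hκγ : ∀ κ ∈ K, κ ⊆ γ₁ ∪ γ₂ := fun κ hκ =>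
    (Set.subset_sUnion_of_mem (Finset.mem_coe.2 hκ)).trans hKγ
  have hpiece : ∀ κ ∈ K, ∃ κ₂ ∈ 𝓚, κ₂ ⊆ κ \ (κ \ γ₂) ∧
      ∀ x ∈ C, (τ κ x, τ (κ \ γ₂) x + τ κ₂ x) ∈ V' := fun κ hκ =>
    h.tight _ (hs.K_diff_G κ (hK hκ) γ₂ hγ₂) κ (hK hκ) Set.sdiff_subset C hC V' hV'
  choose! φ hφ hφsub hφτ using hpiece
  have e₁ := h.sum_mem (κ := fun κ => κ \ γ₂) h₁ K
    (fun κ hκ => hs.K_diff_G κ (hK hκ) γ₂ hγ₂)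
    (fun κ hκ κ' hκ' hne => (hd hκ hκ' hne).mono Set.sdiff_subset Set.sdiff_subset)
    (fun κ hκ s hs' => (hκγ κ hκ hs'.1).resolve_right hs'.2) hx hy
  have e₂ := h.sum_mem (κ := φ) h₂ K hφ
    (fun κ hκ κ' hκ' hne => (hd hκ hκ' hne).mono ((hφsub κ hκ).trans Set.sdiff_subset)
      ((hφsub κ' hκ').trans Set.sdiff_subset))
    (fun κ hκ s hs' => by_contra fun hn => (hφsub κ hκ hs').2 ⟨(hφsub κ hκ hs').1, hn⟩) hx hy
  have e₃ := hadd _ _ _ _ e₁ e₂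
  rw [← Finset.sum_add_distrib, ← Finset.sum_add_distrib] at e₃
  exact hcomp _ _ _ _ (hsum _ _ fun κ hκ => hφτ κ hκ _ (hBC (hx κ hκ))) e₃
    (hsymm _ _ (hsum _ _ fun κ hκ => hφτ κ hκ _ (haddC _ (hx κ hκ) _ (hy κ hκ))))

theorem exists_seq (h : IsTightContent 𝓚 𝓖 𝓑 F T τ) {W : Set (Z × Z)} (hW : W ∈ 𝓤 Z) :
    ∃ w : ℕ → Set (Z × Z), w 0 = W ∧ (∀ n, w n ∈ 𝓤 Z) ∧ ∀ n, ∀ B ∈ 𝓑, ∀ α β,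
      SmallForMeasure 𝓚 𝓖 τ B (w (n + 1)) α → SmallForMeasure 𝓚 𝓖 τ B (w (n + 1)) β →
      SmallForMeasure 𝓚 𝓖 τ B (w n) (α ∪ β) := by
  obtain ⟨w, hw₀, hw⟩ := exists_chain (P := fun W : Set (Z × Z) => W ∈ 𝓤 Z)
    (R := fun W V => ∀ B ∈ 𝓑, ∀ α β, SmallForMeasure 𝓚 𝓖 τ B V α →
      SmallForMeasure 𝓚 𝓖 τ B V β → SmallForMeasure 𝓚 𝓖 τ B W (α ∪ β)) hW
    fun W hW => h.exists_smallForMeasure_union hW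
  exact ⟨w, hw₀, fun n => (hw n).1, fun n => (hw n).2⟩

/-- Tightness writes `τ κ'` as nearly `τ κ + τ κ₁`. Testing smallness on `κ₁` with the values `0`
and `0 + x` shows that `τ κ₁ x` is close to zero. -/
theorem exists_mem_of_small_diff (h : IsTightContent 𝓚 𝓖 𝓑 F T τ) {W : Set (Z × Z)}
    (hW : W ∈ 𝓤 Z) :
    ∃ V ∈ 𝓤 Z, ∀ B ∈ 𝓑, ∀ κ ∈ 𝓚, ∀ κ' ∈ 𝓚, κ ⊆ κ' → SmallForMeasure 𝓚 𝓖 τ B V (κ' \ κ) →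
      ∀ x ∈ B, (τ κ x, τ κ' x) ∈ W := by
  obtain ⟨W₁, hW₁, -, hsymm, hcomp⟩ := exists_symm_comp_three hW
  obtain ⟨V, hV, hadd⟩ := exists_add_mem_uniformity hW₁
  refine ⟨V, hV, fun B hB κ hκ κ' hκ' hκκ' => ?_⟩
  rintro ⟨γ, hγ, hsub, h₁⟩ x hx
  obtain ⟨κ₁, hκ₁, hκ₁sub, hτ⟩ := h.tight κ hκ κ' hκ' hκκ' B hB W₁ hW₁
  have e := h₁ {κ₁} (by simpa using hκ₁) (by simp) (by simpa using hκ₁sub.trans hsub)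
    (fun _ => 0) (fun _ => x) (fun _ _ => h.system.zero_mem_B B hB) (fun _ _ => hx)
  simp only [Finset.sum_singleton, zero_add, h.map_zero κ₁ hκ₁] at e
  have e' := hadd _ _ _ _ (refl_mem_uniformity hV : (τ κ x, τ κ x) ∈ V) e
  rw [add_zero] at e'
  exact hcomp _ _ _ _ e' (hsymm _ _ (hτ x hx)) (refl_mem_uniformity hW₁)

/-- Disjoint sequences in `𝓚` eventually consist of small sets. -/
theorem exhaustive_K (h : IsTightContent 𝓚 𝓖 𝓑 F T τ) {B : Set X} (hB : B ∈ 𝓑)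
    {W : Set (Z × Z)} (hW : W ∈ 𝓤 Z) {κ : ℕ → Set S} (hκ : ∀ n, κ n ∈ 𝓚)
    (hd : Pairwise fun i j => Disjoint (κ i) (κ j)) :
    ∃ n, SmallForMeasure 𝓚 𝓖 τ B W (κ n) := by
  have hs := h.system
  obtain ⟨w, rfl, hw, hunion⟩ := h.exists_seq hW
  -- The index `1 + n + 1` makes all the errors `γ n \ κ n` together fit into `w 1`.
  choose γ hγ hκγ hsm using fun n => h.outer (κ n) (hκ n) B hB (w (1 + n + 1)) (hw _)
  choose ω hω κ' hκ' hκω hωκ' hκ'γ using fun n => hs.interpolate (κ n) (hκ n) (γ n) (hγ n) (hκγ n)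
  have hP : ∀ n, (⋃ i < n, κ' i) ∈ 𝓚 := by
    intro n
    induction n with
    | zero => simpa using hs.K_empty
    | succ n ih => rw [Set.biUnion_lt_succ]; exact hs.K_union ih (hκ' n)
  obtain ⟨m, hm⟩ := h.exhaustive B hB (w 1) (hw 1) (fun n => ω n \ ⋃ i < n, κ' i)
    (fun n => hs.G_diff_K _ (hP n) _ (hω n)) ((pairwise_disjoint_on _).2 fun i j hij => by
      refine Set.disjoint_left.2 fun s hi hj => hj.2 ?_
      exact Set.mem_biUnion (show i ∈ {i | i < j} from hij) (hωκ' i hi.1))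
  -- A point of `κ (m + 1)` lying in an earlier `κ' i` lies in `γ i \ κ i`, as the `κ i` are
  -- disjoint. The other points lie in the disjointified set `ω (m + 1) \ ⋃ i < m + 1, κ' i`.
  refine ⟨m + 1, (hunion 0 B hB _ _ (hm (m + 1) (Nat.lt_succ_self m))
    (h.smallForMeasure_iUnion hw (fun n => hunion n B hB) (m + 1) 1 hsm)).anti fun s hs' => ?_⟩
  by_cases h₁ : s ∈ ⋃ i < m + 1, κ' i
  · right
    simp only [Set.mem_iUnion] at h₁ ⊢
    obtain ⟨i, hi, hsi⟩ := h₁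
    exact ⟨i, hi, hκ'γ i hsi, fun hsκ => Set.disjoint_left.1 (hd hi.ne) hsκ hs'⟩
  · exact Or.inl ⟨hκω _ hs', h₁⟩

/-- Otherwise a decreasing sequence of neighbourhoods of `α` would shed, at each stage, a member of
`𝓚` that is not small; these are disjoint, contradicting `exhaustive_K`. This is the Cauchy
condition for `ξ` around an arbitrary set, regular or not. -/
theorem exists_outer_approx (h : IsTightContent 𝓚 𝓖 𝓑 F T τ) (α : Set S) {B : Set X} (hB : B ∈ 𝓑)
    {W : Set (Z × Z)} (hW : W ∈ 𝓤 Z) :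
    ∃ γ ∈ 𝓖, α ⊆ γ ∧ ∀ γ' ∈ 𝓖, α ⊆ γ' → ∀ κ ∈ 𝓚, κ ⊆ γ →
      SmallForMeasure 𝓚 𝓖 τ B W (κ \ γ') := by
  by_contra! hcon
  have hs := h.system
  obtain ⟨u, -, hu⟩ := exists_chain (P := fun γ => γ ∈ 𝓖 ∧ α ⊆ γ)
    (R := fun γ γ' => γ' ⊆ γ ∧ ∃ κ ∈ 𝓚, κ ⊆ γ ∧ Disjoint κ γ' ∧ ¬SmallForMeasure 𝓚 𝓖 τ B W κ)
    (c₀ := Set.univ) ⟨hs.G_univ, Set.subset_univ _⟩ (by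
      rintro γ ⟨hγ, hαγ⟩
      obtain ⟨γ', hγ', hαγ', κ, hκ, hκγ, hsm⟩ := hcon γ hγ hαγ
      exact ⟨γ ∩ γ', ⟨hs.G_inter hγ hγ', Set.subset_inter hαγ hαγ'⟩, Set.inter_subset_left,
        κ \ γ', hs.K_diff_G κ hκ γ' hγ', Set.sdiff_subset.trans hκγ,
        Set.disjoint_left.2 fun s h₁ h₂ => h₁.2 h₂.2, hsm⟩)
  choose hP hR κ hκ hκu hκd hκs using hu
  have hanti : Antitone u := antitone_nat_of_succ_le hR
  obtain ⟨n, hn⟩ := h.exhaustive_K hB hW hκ ((pairwise_disjoint_on κ).2 fun i j hij =>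
    (hκd i).mono_right ((hκu j).trans (hanti hij)))
  exact hκs n hn

end IsTightContent

end Content

/-! ### Existence and approximation of the limits `ξ` and `ν`. -/

namespace IsTightContent

section Limits

variable [UniformSpace X] [AddCommMonoid X] [UniformSpace Z] [AddCommMonoid Z]
  {𝓚 𝓖 : Set (Set S)} {𝓑 : Set (Set X)} {F : AddSubmonoid (S → X)} {T : UniformSpace F}
  {τ ξ ν : Set S → X → Z}

theorem atTop_neBot (h : IsTightContent 𝓚 𝓖 𝓑 F T τ) (γ : Set S) :
    (atTop : Filter {κ : Set S // κ ∈ 𝓚 ∧ κ ⊆ γ}).NeBot := by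
  have : Nonempty {κ : Set S // κ ∈ 𝓚 ∧ κ ⊆ γ} := ⟨⟨∅, h.system.K_empty, Set.empty_subset _⟩⟩
  have : IsDirectedOrder {κ : Set S // κ ∈ 𝓚 ∧ κ ⊆ γ} := ⟨fun κ κ' =>
    ⟨⟨κ.1 ∪ κ'.1, h.system.K_union κ.2.1 κ'.2.1, Set.union_subset κ.2.2 κ'.2.2⟩,
      Set.subset_union_left, Set.subset_union_right⟩⟩
  infer_instance

theorem atBot_neBot (h : IsTightContent 𝓚 𝓖 𝓑 F T τ) (α : Set S) :
    (atBot : Filter {γ : Set S // γ ∈ 𝓖 ∧ α ⊆ γ}).NeBot := by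
  have : Nonempty {γ : Set S // γ ∈ 𝓖 ∧ α ⊆ γ} := ⟨⟨Set.univ, h.system.G_univ, Set.subset_univ _⟩⟩
  have : IsCodirectedOrder {γ : Set S // γ ∈ 𝓖 ∧ α ⊆ γ} := ⟨fun γ γ' =>
    ⟨⟨γ.1 ∩ γ'.1, h.system.G_inter γ.2.1 γ'.2.1, Set.subset_inter γ.2.2 γ'.2.2⟩,
      Set.inter_subset_left, Set.inter_subset_right⟩⟩
  infer_instance

variable [IsUniformAddCommMonoid Z]

theorem exists_tendsto_K (h : IsTightContent 𝓚 𝓖 𝓑 F T τ) {γ : Set S} (hγ : γ ∈ 𝓖) :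
    ∃ z : X → Z, Tendsto (fun κ : {κ : Set S // κ ∈ 𝓚 ∧ κ ⊆ γ} => τ κ.1) atTop (𝓝 z) := by
  have := h.atTop_neBot γ
  suffices H : ∀ x, ∃ z, Tendsto (fun κ : {κ : Set S // κ ∈ 𝓚 ∧ κ ⊆ γ} => τ κ.1 x) atTop (𝓝 z) by
    choose z hz using H
    exact ⟨z, tendsto_pi_nhds.2 hz⟩
  intro x
  obtain ⟨C, hC, hτC⟩ := h.complete x
  obtain ⟨B, hB, hx⟩ := h.system.B_cover x
  obtain ⟨z, -, hz⟩ := exists_tendsto_of_isComplete hC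
    (u := fun κ : {κ : Set S // κ ∈ 𝓚 ∧ κ ⊆ γ} => τ κ.1 x) (l := atTop)
    (fun κ => hτC κ.1 κ.2.1) fun W hW => by
      obtain ⟨V, hV, h₁⟩ := h.exists_mem_of_small_diff hW
      obtain ⟨κ, hκ, hκγ, hsm⟩ := h.inner γ hγ B hB V hV
      refine ⟨τ κ x, (eventually_ge_atTop ⟨κ, hκ, hκγ⟩).mono fun κ' hκ' => ?_⟩
      exact h₁ B hB κ hκ κ'.1 κ'.2.1 hκ' (hsm.anti (Set.sdiff_subset_sdiff_left κ'.2.2)) x hx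
  exact ⟨z, hz⟩

variable (hξ : ∀ γ ∈ 𝓖, Tendsto (fun κ : {κ : Set S // κ ∈ 𝓚 ∧ κ ⊆ γ} => τ κ.1) atTop (𝓝 (ξ γ)))

include hξ

theorem exists_mem_xi (h : IsTightContent 𝓚 𝓖 𝓑 F T τ) {W : Set (Z × Z)} (hW : W ∈ 𝓤 Z) :
    ∃ V ∈ 𝓤 Z, ∀ B ∈ 𝓑, ∀ κ ∈ 𝓚, ∀ γ ∈ 𝓖, κ ⊆ γ → SmallForMeasure 𝓚 𝓖 τ B V (γ \ κ) →
      ∀ x ∈ B, (τ κ x, ξ γ x) ∈ W := by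
  obtain ⟨W₁, hW₁, -, hsymm, hcomp⟩ := exists_symm_comp_three hW
  obtain ⟨V, hV, h₁⟩ := h.exists_mem_of_small_diff hW₁
  refine ⟨V, hV, fun B hB κ hκ γ hγ hκγ hsm x hx => ?_⟩
  have := h.atTop_neBot γ
  refine mem_of_eventually_mem_of_tendsto hW₁ hsymm hcomp (tendsto_pi_nhds.1 (hξ γ hγ) x)
    ((eventually_ge_atTop ⟨κ, hκ, hκγ⟩).mono fun κ' hκ' => ?_)
  exact h₁ B hB κ hκ κ'.1 κ'.2.1 hκ' (hsm.anti (Set.sdiff_subset_sdiff_left κ'.2.2)) x hx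

theorem exists_tendsto_G [T2Space Z] (h : IsTightContent 𝓚 𝓖 𝓑 F T τ) (α : Set S) :
    ∃ z : X → Z, Tendsto (fun γ : {γ : Set S // γ ∈ 𝓖 ∧ α ⊆ γ} => ξ γ.1) atBot (𝓝 z) := by
  have := h.atBot_neBot α
  suffices H : ∀ x, ∃ z, Tendsto (fun γ : {γ : Set S // γ ∈ 𝓖 ∧ α ⊆ γ} => ξ γ.1 x) atBot (𝓝 z) by
    choose z hz using H
    exact ⟨z, tendsto_pi_nhds.2 hz⟩
  intro x
  obtain ⟨C, hC, hτC⟩ := h.complete x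
  obtain ⟨B, hB, hx⟩ := h.system.B_cover x
  obtain ⟨z, -, hz⟩ := exists_tendsto_of_isComplete hC
    (u := fun γ : {γ : Set S // γ ∈ 𝓖 ∧ α ⊆ γ} => ξ γ.1 x) (l := atBot)
    (fun γ => by
      have := h.atTop_neBot γ.1
      exact hC.isClosed.mem_of_tendsto (tendsto_pi_nhds.1 (hξ γ.1 γ.2.1) x)
        (Eventually.of_forall fun κ => hτC κ.1 κ.2.1)) fun W hW => by
      obtain ⟨W₁, hW₁, -, hsymm, hcomp⟩ := exists_symm_comp_three hW
      obtain ⟨V, hV, h₁⟩ := h.exists_mem_of_small_diff hW₁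
      obtain ⟨V₁, hV₁, h₂⟩ := h.exists_mem_xi hξ hW₁
      obtain ⟨V₂, hV₂, h₃⟩ := h.exists_smallForMeasure_union hV
      obtain ⟨γ, hγ, hαγ, hsm⟩ := h.exists_outer_approx α hB hV₂
      obtain ⟨κ, hκ, hκγ, hsmκ⟩ := h.inner γ hγ B hB V₁ hV₁
      -- For `γ' ⊆ γ`, the comparison runs from `ξ γ` to `τ (κ ∪ κ')`, then to `τ κ'`, then to `ξ
      -- γ'`. The middle step uses that `(κ ∪ κ') \ κ'` is covered by `(κ ∪ κ') \ γ'` and `γ' \ κ'`.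
      refine ⟨ξ γ x, (eventually_le_atBot ⟨γ, hγ, hαγ⟩).mono fun γ' hγ' => ?_⟩
      obtain ⟨κ', hκ', hκγ', hsmκ'⟩ := h.inner γ'.1 γ'.2.1 B hB (V₁ ∩ V₂) (inter_mem hV₁ hV₂)
      have hu := h.system.K_union hκ hκ'
      have huγ : κ ∪ κ' ⊆ γ := Set.union_subset hκγ (hκγ'.trans hγ')
      have e₁ := h₂ B hB _ hu γ hγ huγ
        (hsmκ.anti (Set.sdiff_subset_sdiff_right Set.subset_union_left)) x hx
      have e₂ := h₂ B hB κ' hκ' γ'.1 γ'.2.1 hκγ' (hsmκ'.mono Set.inter_subset_left) x hx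
      have e₃ := h₁ B hB κ' hκ' _ hu Set.subset_union_right
        ((h₃ B hB _ _ (hsm γ'.1 γ'.2.1 γ'.2.2 _ hu huγ)
          (hsmκ'.mono Set.inter_subset_right)).anti fun s hs => by
            by_cases h₄ : s ∈ γ'.1
            · exact Or.inr ⟨h₄, hs.2⟩
            · exact Or.inl ⟨hs.1, h₄⟩) x hx
      exact hcomp _ _ _ _ (hsymm _ _ e₁) (hsymm _ _ e₃) e₂
  exact ⟨z, hz⟩

variable (hν : ∀ α : Set S,
  Tendsto (fun γ : {γ : Set S // γ ∈ 𝓖 ∧ α ⊆ γ} => ξ γ.1) atBot (𝓝 (ν α)))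

include hν

theorem exists_mem_nu (h : IsTightContent 𝓚 𝓖 𝓑 F T τ) {W : Set (Z × Z)} (hW : W ∈ 𝓤 Z) :
    ∃ V ∈ 𝓤 Z, ∀ B ∈ 𝓑, ∀ κ ∈ 𝓚, ∀ γ ∈ 𝓖, ∀ α, κ ⊆ α → α ⊆ γ →
      SmallForMeasure 𝓚 𝓖 τ B V (γ \ κ) → ∀ x ∈ B, (τ κ x, ν α x) ∈ W := by
  obtain ⟨W₁, hW₁, -, hsymm, hcomp⟩ := exists_symm_comp_three hW
  obtain ⟨V, hV, h₁⟩ := h.exists_mem_xi hξ hW₁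
  refine ⟨V, hV, fun B hB κ hκ γ hγ α hκα hαγ hsm x hx => ?_⟩
  have := h.atBot_neBot α
  refine mem_of_eventually_mem_of_tendsto hW₁ hsymm hcomp (tendsto_pi_nhds.1 (hν α) x)
    ((eventually_le_atBot ⟨γ, hγ, hαγ⟩).mono fun γ' hγ' => ?_)
  exact h₁ B hB κ hκ γ'.1 γ'.2.1 (hκα.trans γ'.2.2)
    (hsm.anti (Set.sdiff_subset_sdiff_left hγ')) x hx

/-- This is the comparison of `ν α` with `τ κ` for `κ = ∅`. -/
theorem exists_nu_mem_of_small (h : IsTightContent 𝓚 𝓖 𝓑 F T τ) {W : Set (Z × Z)}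
    (hW : W ∈ 𝓤 Z) :
    ∃ V ∈ 𝓤 Z, ∀ B ∈ 𝓑, ∀ α, SmallForMeasure 𝓚 𝓖 τ B V α → ∀ x ∈ B, (0, ν α x) ∈ W := by
  obtain ⟨V, hV, h₁⟩ := h.exists_mem_nu hξ hν hW
  refine ⟨V, hV, fun B hB α => ?_⟩
  rintro ⟨γ, hγ, hαγ, hsm⟩ x hx
  have e := h₁ B hB ∅ h.system.K_empty γ hγ α (Set.empty_subset _) hαγ
    ⟨γ, hγ, Set.sdiff_subset, hsm⟩ x hx
  rwa [h.map_empty] at e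

theorem nu_eq_of_mem_K [T2Space Z] (h : IsTightContent 𝓚 𝓖 𝓑 F T τ) {κ : Set S} (hκ : κ ∈ 𝓚) :
    ν κ = τ κ := by
  refine funext fun x => (eq_of_forall_mem_uniformity fun W hW => ?_).symm
  obtain ⟨B, hB, hx⟩ := h.system.B_cover x
  obtain ⟨V, hV, h₁⟩ := h.exists_mem_nu hξ hν hW
  obtain ⟨γ, hγ, hκγ, hsm⟩ := h.outer κ hκ B hB V hV
  exact h₁ B hB κ hκ γ hγ κ subset_rfl hκγ hsm x hx

end Limits

/-! ### The field of regular sets and the measure `ν`. -/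

section Measure

variable [UniformSpace X] [AddCommMonoid X] [UniformSpace Z] [AddCommMonoid Z]
  {𝓚 𝓖 : Set (Set S)} {𝓑 : Set (Set X)} {F : AddSubmonoid (S → X)} {T : UniformSpace F}
  {τ ξ ν : Set S → X → Z}

theorem mem_regularSets_of_mem_K (h : IsTightContent 𝓚 𝓖 𝓑 F T τ) {κ : Set S} (hκ : κ ∈ 𝓚) :
    κ ∈ regularSets 𝓚 𝓖 𝓑 τ := fun B hB V hV =>
  let ⟨γ, hγ, hκγ, hsm⟩ := h.outer κ hκ B hB V hV
  ⟨κ, hκ, γ, hγ, subset_rfl, hκγ, hsm⟩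

theorem mem_regularSets_of_mem_G (h : IsTightContent 𝓚 𝓖 𝓑 F T τ) {γ : Set S} (hγ : γ ∈ 𝓖) :
    γ ∈ regularSets 𝓚 𝓖 𝓑 τ := fun B hB V hV =>
  let ⟨κ, hκ, hκγ, hsm⟩ := h.inner γ hγ B hB V hV
  ⟨κ, hκ, γ, hγ, hκγ, subset_rfl, hsm⟩

variable [IsUniformAddCommMonoid Z]

theorem isSetAlgebra_regularSets (h : IsTightContent 𝓚 𝓖 𝓑 F T τ) :
    MeasureTheory.IsSetAlgebra (regularSets 𝓚 𝓖 𝓑 τ) where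
  empty_mem := h.mem_regularSets_of_mem_K h.system.K_empty
  compl_mem := fun α hα B hB V hV => by
    have hs := h.system
    obtain ⟨V₁, hV₁, h₁⟩ := h.exists_smallForMeasure_union hV
    obtain ⟨κ, hκ, γ, hγ, hκα, hαγ, hsm⟩ := hα B hB V₁ hV₁
    -- The whole space need not belong to `𝓚`, so it is replaced by a `κ₀` with small complement;
    -- then `κ₀ \ γ` approximates the complement of `α` from inside.
    obtain ⟨κ₀, hκ₀, -, hsm₀⟩ := h.inner _ hs.G_univ B hB V₁ hV₁
    refine ⟨κ₀ \ γ, hs.K_diff_G _ hκ₀ _ hγ, κᶜ, hs.G_compl hκ, fun s hs' hsα => hs'.2 (hαγ hsα),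
      Set.compl_subset_compl.2 hκα, (h₁ B hB _ _ hsm₀ hsm).anti fun s hs' => ?_⟩
    by_cases h₂ : s ∈ κ₀
    · exact Or.inr ⟨by_contra fun h₃ => hs'.2 ⟨h₂, h₃⟩, hs'.1⟩
    · exact Or.inl ⟨Set.mem_univ _, h₂⟩
  union_mem := fun α β hα hβ B hB V hV => by
    have hs := h.system
    obtain ⟨V₁, hV₁, h₁⟩ := h.exists_smallForMeasure_union hV
    obtain ⟨κ, hκ, γ, hγ, hκα, hαγ, hsm⟩ := hα B hB V₁ hV₁
    obtain ⟨κ', hκ', γ', hγ', hκβ, hβγ, hsm'⟩ := hβ B hB V₁ hV₁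
    refine ⟨κ ∪ κ', hs.K_union hκ hκ', γ ∪ γ', hs.G_union hγ hγ',
      Set.union_subset_union hκα hκβ, Set.union_subset_union hαγ hβγ,
      (h₁ B hB _ _ hsm hsm').anti ?_⟩
    rintro s ⟨hs' | hs', hn⟩
    · exact Or.inl ⟨hs', fun h₂ => hn (Or.inl h₂)⟩
    · exact Or.inr ⟨hs', fun h₂ => hn (Or.inr h₂)⟩

variable [T2Space Z]
  (hξ : ∀ γ ∈ 𝓖, Tendsto (fun κ : {κ : Set S // κ ∈ 𝓚 ∧ κ ⊆ γ} => τ κ.1) atTop (𝓝 (ξ γ)))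
  (hν : ∀ α : Set S,
    Tendsto (fun γ : {γ : Set S // γ ∈ 𝓖 ∧ α ⊆ γ} => ξ γ.1) atBot (𝓝 (ν α)))

include hξ hν

theorem nu_empty (h : IsTightContent 𝓚 𝓖 𝓑 F T τ) : ν ∅ = 0 := by
  rw [h.nu_eq_of_mem_K hξ hν h.system.K_empty]
  exact funext h.map_empty

theorem nu_union (h : IsTightContent 𝓚 𝓖 𝓑 F T τ) {α β : Set S} (hα : α ∈ regularSets 𝓚 𝓖 𝓑 τ)
    (hβ : β ∈ regularSets 𝓚 𝓖 𝓑 τ) (hd : Disjoint α β) : ν (α ∪ β) = ν α + ν β := by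
  have hs := h.system
  refine funext fun x => eq_of_forall_mem_uniformity fun W hW => ?_
  obtain ⟨B, hB, hx⟩ := hs.B_cover x
  obtain ⟨W₁, hW₁, -, hsymm, hcomp⟩ := exists_symm_comp_three hW
  obtain ⟨W₂, hW₂, hadd⟩ := exists_add_mem_uniformity hW₁
  obtain ⟨V, hV, h₁⟩ := h.exists_mem_nu hξ hν (inter_mem hW₁ hW₂)
  obtain ⟨V₁, hV₁, h₂⟩ := h.exists_smallForMeasure_union hV
  obtain ⟨κ, hκ, γ, hγ, hκα, hαγ, hsm⟩ := hα B hB _ (inter_mem hV hV₁)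
  obtain ⟨κ', hκ', γ', hγ', hκβ, hβγ, hsm'⟩ := hβ B hB _ (inter_mem hV hV₁)
  have e := h₁ B hB _ (hs.K_union hκ hκ') _ (hs.G_union hγ hγ') (α ∪ β)
    (Set.union_subset_union hκα hκβ) (Set.union_subset_union hαγ hβγ)
    ((h₂ B hB _ _ (hsm.mono Set.inter_subset_right) (hsm'.mono Set.inter_subset_right)).anti (by
      rintro s ⟨hs' | hs', hn⟩
      · exact Or.inl ⟨hs', fun h₂ => hn (Or.inl h₂)⟩
      · exact Or.inr ⟨hs', fun h₂ => hn (Or.inr h₂)⟩)) x hx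
  rw [h.map_union κ hκ κ' hκ' (hd.mono hκα hκβ)] at e
  have e₁ := h₁ B hB κ hκ γ hγ α hκα hαγ (hsm.mono Set.inter_subset_left) x hx
  have e₂ := h₁ B hB κ' hκ' γ' hγ' β hκβ hβγ (hsm'.mono Set.inter_subset_left) x hx
  exact hcomp _ _ _ _ (hsymm _ _ e.1) (hadd _ _ _ _ e₁.2 e₂.2) (refl_mem_uniformity hW₁)

theorem nu_biUnion (h : IsTightContent 𝓚 𝓖 𝓑 F T τ) {A : ℕ → Set S}
    (hA : ∀ n, A n ∈ regularSets 𝓚 𝓖 𝓑 τ) (hd : Pairwise fun i j => Disjoint (A i) (A j))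
    (s : Finset ℕ) : ν (⋃ i ∈ s, A i) = ∑ i ∈ s, ν (A i) := by
  classical
  induction s using Finset.induction_on with
  | empty => simpa using h.nu_empty hξ hν
  | insert i s hi ih =>
    rw [Finset.set_biUnion_insert, Finset.sum_insert hi, ← ih]
    refine h.nu_union hξ hν (hA i) (h.isSetAlgebra_regularSets.biUnion_mem s fun j _ => hA j) ?_
    exact Set.disjoint_iUnion₂_right.2 fun j hj => hd fun hij => hi (hij ▸ hj)

theorem isCountablyAdditiveOn (h : IsTightContent 𝓚 𝓖 𝓑 F T τ)
    (hbdd : ∀ W ∈ 𝓤 Z, ∀ B ∈ 𝓑, ∀ κ ∈ 𝓚, ∀ G' ⊆ 𝓖, κ ⊆ ⋃₀ G' →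
      ∃ H ⊆ G', H.Finite ∧ SmallForMeasure 𝓚 𝓖 τ B W (κ \ ⋃₀ H)) :
    IsCountablyAdditiveOn ν (regularSets 𝓚 𝓖 𝓑 τ) where
  isSetAlgebra := h.isSetAlgebra_regularSets
  map_empty := h.nu_empty hξ hν
  map_union_add_inter := fun A hA B hB => by
    have halg := h.isSetAlgebra_regularSets
    have hBA := halg.sdiff_mem hB hA
    have e₁ := h.nu_union hξ hν hA hBA Set.disjoint_sdiff_right
    have e₂ := h.nu_union hξ hν (halg.inter_mem hA hB) hBA
      (Set.disjoint_sdiff_right.mono_left Set.inter_subset_left)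
    rw [Set.union_sdiff_self] at e₁
    rw [Set.inter_comm, Set.inter_union_sdiff] at e₂
    rw [e₁, e₂, Set.inter_comm B A, add_assoc, add_comm (ν (B \ A))]
  hasSum := fun A hA hd hU => by
    have halg := h.isSetAlgebra_regularSets
    refine tendsto_pi_nhds.2 fun x => ?_
    refine (Uniform.tendsto_nhds_right).2 fun W hW => ?_
    obtain ⟨B, hB, hx⟩ := h.system.B_cover x
    obtain ⟨W₁, hW₁, -, hsymm, hcomp⟩ := exists_symm_comp_three hW
    obtain ⟨W₂, hW₂, hadd⟩ := exists_add_mem_uniformity hW₁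
    obtain ⟨V, hV, h₁⟩ := h.exists_nu_mem_of_small hξ hν hW₂
    obtain ⟨w, rfl, hw, hunion⟩ := h.exists_seq hV
    obtain ⟨κ, hκ, δ, hδ, hκU, hUδ, hsm⟩ := hU B hB (w 1) (hw 1)
    -- The entourages are budgeted as follows: `w 1` for the part of the union outside `κ`, `w 2`
    -- for the part of `κ` missed by the finite subcover, and `w (2 + n + 1)` for the `n`-th
    -- enlargement, adding up to `w 2`.
    choose κ' hκ' γ hγ hκA hAγ hsmγ using fun n => hA n B hB (w (2 + n + 1)) (hw _)
    obtain ⟨H, hHγ, hHfin, hsmH⟩ := hbdd (w 2) (hw 2) B hB κ hκ (Set.range γ)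
      (Set.range_subset_iff.2 hγ) (by
        rw [Set.sUnion_range]
        exact hκU.trans (Set.iUnion_mono hAγ))
    choose! n hn using fun β (hβ : β ∈ H) => hHγ hβ
    obtain ⟨N, hN⟩ := (hHfin.image n).bddAbove
    -- A point of the remainder either avoids `κ`, or lies in `κ` outside the finite subcover, or
    -- lies in some `γ i` with `i ≤ N`. In the last case it is not in `A i`, hence not in `κ' i`.
    have hsmall : SmallForMeasure 𝓚 𝓖 τ B (w 0) ((⋃ n, A n) \ ⋃ i ∈ Finset.range (N + 1), A i) := by
      refine (hunion 0 B hB _ _ hsm (hunion 1 B hB _ _ hsmH (h.smallForMeasure_iUnion hw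
        (fun n => hunion n B hB) (N + 1) 2 hsmγ))).anti fun s hs => ?_
      by_cases hsκ : s ∈ κ
      · refine Or.inr ?_
        by_cases hsH : s ∈ ⋃₀ H
        · obtain ⟨β, hβ, hsβ⟩ := hsH
          have hle : n β < N + 1 := Nat.lt_succ_of_le (hN (Set.mem_image_of_mem n hβ))
          rw [← hn β hβ] at hsβ
          refine Or.inr (Set.mem_biUnion (show n β ∈ {i | i < N + 1} from hle) ⟨hsβ, fun h₂ => ?_⟩)
          exact hs.2 (Set.mem_biUnion (Finset.mem_coe.2 (Finset.mem_range.2 hle)) (hκA _ h₂))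
        · exact Or.inl ⟨hsκ, hsH⟩
      · exact Or.inl ⟨hUδ hs.1, hsκ⟩
    rw [SummationFilter.unconditional_filter, mem_map]
    -- Larger index sets leave smaller remainders, so the bound holds along all finite sets, which
    -- gives unconditional convergence.
    filter_upwards [eventually_ge_atTop (Finset.range (N + 1))] with s hs
    have hs' : (⋃ i ∈ s, A i) ∈ regularSets 𝓚 𝓖 𝓑 τ := halg.biUnion_mem s fun j _ => hA j
    have e := h.nu_union hξ hν hs' (halg.sdiff_mem hU hs') Set.disjoint_sdiff_right
    rw [Set.union_sdiff_cancel (Set.iUnion₂_subset fun i _ => Set.subset_iUnion A i),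
      h.nu_biUnion hξ hν hA hd] at e
    have e₁ : (0, ν ((⋃ n, A n) \ ⋃ i ∈ s, A i) x) ∈ W₂ :=
      h₁ B hB _ (hsmall.anti (Set.sdiff_subset_sdiff_right
      (Set.biUnion_subset_biUnion_left hs))) x hx
    have e₂ := hadd _ _ _ _ (refl_mem_uniformity hW₂ : ((∑ i ∈ s, ν (A i)) x, _) ∈ W₂) e₁
    rw [add_zero, ← Pi.add_apply, ← e] at e₂
    rw [Finset.sum_apply] at e₂
    exact hcomp _ _ _ _ (hsymm _ _ (by simpa using e₂)) (refl_mem_uniformity hW₁)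
      (refl_mem_uniformity hW₁)

end Measure

end IsTightContent

/-! ### From the Riesz integral to the tight content, and the conclusion. -/

theorem IsRieszIntegral.isTightContent_tau {S X Z : Type*} [UniformSpace X] [AddCommMonoid X]
    [UniformSpace Z] [AddCommMonoid Z] [IsUniformAddCommMonoid Z] [T2Space Z]
    {𝓚 𝓖 : Set (Set S)} {𝓑 : Set (Set X)} {F : AddSubmonoid (S → X)} {T : UniformSpace F}
    {ℓ : F → Z} (h : IsRieszIntegral 𝓚 𝓖 𝓑 F T ℓ) :
    IsTightContent 𝓚 𝓖 𝓑 F T (tau 𝓚 𝓖 𝓑 ℓ) where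
  system := h.system
  map_zero := fun _ hκ => h.tau_zero hκ
  map_empty := h.tau_empty
  map_union := fun _ hκ₁ _ hκ₂ hd x => h.tau_union hκ₁ hκ₂ hd x
  tight := fun _ hκ _ hκ' hκκ' _ hB _ hW => h.exists_tau_add_mem hκ hκ' hκκ' hB hW
  outer := fun κ hκ B hB W hW => by
    obtain ⟨V, hV, h₁⟩ := h.exists_smallForMeasure_tau hW
    obtain ⟨γ, hγ, hκγ, -, hsm⟩ :=
      h.exists_smallOpens_diff_of_mem_K hκ h.system.G_univ (Set.subset_univ _) hB hV
    exact ⟨γ, hγ, hκγ, h₁ B hB _ ⟨_, hsm, subset_rfl⟩⟩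
  inner := fun γ hγ B hB W hW => by
    obtain ⟨V, hV, h₁⟩ := h.exists_smallForMeasure_tau hW
    obtain ⟨κ, hκ, hκγ, hsm⟩ := h.exists_smallOpens_diff_of_mem_G hγ hB hV
    exact ⟨κ, hκ, hκγ, h₁ B hB _ ⟨_, hsm, subset_rfl⟩⟩
  exhaustive := fun B hB W hW γ hγ hd => by
    obtain ⟨V, hV, h₁⟩ := h.exists_smallForMeasure_tau hW
    obtain ⟨m, hm⟩ := h.sBounded B hB V hV γ hγ hd
    exact ⟨m, fun n hn => h₁ B hB _ ⟨_, ⟨hγ n, hm n hn⟩, subset_rfl⟩⟩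
  complete := fun x => ⟨_, h.relComplete _ (h.system.hull_mem x),
    fun _ hκ => h.tau_mem_closure hκ x⟩

end RieszRep

theorem theorem5p7 {S X Z : Type*}
    [UniformSpace X] [AddCommMonoid X] [IsUniformAddCommMonoid X]
    [UniformSpace Z] [AddCommMonoid Z] [IsUniformAddCommMonoid Z] [T2Space Z]
    (𝓚 𝓖 : Set (Set S)) (𝓑 : Set (Set X)) (F : AddSubmonoid (S → X)) (T : UniformSpace F)
    (ℓ : F → Z)
    (hint : RieszRep.IsRieszIntegral 𝓚 𝓖 𝓑 F T ℓ)
    (hbdd : RieszRep.GBounded 𝓚 𝓖 𝓑 ℓ) :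
    RieszRep.NuWellDefined 𝓚 𝓖 𝓑 ℓ ∧
    𝓚 ∪ 𝓖 ⊆ RieszRep.regularSets 𝓚 𝓖 𝓑 (RieszRep.nu 𝓚 𝓖 𝓑 ℓ) ∧
    RieszRep.IsCountablyAdditiveOn (RieszRep.nu 𝓚 𝓖 𝓑 ℓ)
      (RieszRep.regularSets 𝓚 𝓖 𝓑 (RieszRep.nu 𝓚 𝓖 𝓑 ℓ)) := by
  have h := hint.isTightContent_tau
  have hξ : ∀ γ ∈ 𝓖, Tendsto
      (fun κ : {κ : Set S // κ ∈ 𝓚 ∧ κ ⊆ γ} => RieszRep.tau 𝓚 𝓖 𝓑 ℓ κ.1)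
      atTop (𝓝 (RieszRep.xi 𝓚 𝓖 𝓑 ℓ γ)) := fun γ hγ =>
    tendsto_nhds_limUnder (h.exists_tendsto_K hγ)
  have hν : ∀ α : Set S, Tendsto
      (fun γ : {γ : Set S // γ ∈ 𝓖 ∧ α ⊆ γ} => RieszRep.xi 𝓚 𝓖 𝓑 ℓ γ.1)
      atBot (𝓝 (RieszRep.nu 𝓚 𝓖 𝓑 ℓ α)) := fun α =>
    tendsto_nhds_limUnder (h.exists_tendsto_G hξ α)
  rw [RieszRep.regularSets_congr fun κ hκ => h.nu_eq_of_mem_K hξ hν hκ]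
  refine ⟨⟨fun κ hκ => hint.tauFilter_neBot hκ, fun κ hκ => hint.tauFilter_le_nhds_tau hκ, hξ, hν⟩,
    Set.union_subset (fun κ hκ => h.mem_regularSets_of_mem_K hκ)
      (fun γ hγ => h.mem_regularSets_of_mem_G hγ),
    h.isCountablyAdditiveOn hξ hν fun W hW B hB κ hκ G' hG' hκG' => ?_⟩
  obtain ⟨V, hV, h₁⟩ := hint.exists_smallForMeasure_tau hW
  obtain ⟨H, hHG, hfin, hsm⟩ := hbdd V hV B hB κ hκ G' hG' hκG'
  exact ⟨H, hHG, hfin, h₁ B hB _ hsm⟩
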